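/- Let $d\ge 2$ and $m_k=-1/(d^k-1)$. A meter on $\mathbb C^d$ is a finite family of positive semidefinite operators with sum $\mathbb 1$; $G$ is a joint meter for $M,N$ if it is a meter with $\sum_yG(x,y)=M(x)$ and $\sum_xG(x,y)=N(y)$. A sharp meter is $Q(x)=|\varphi_x\rangle\langle\varphi_x|$, $x=0,\dots,d-1$, for an orthonormal basis $(\varphi_x)$ of $\mathbb C^d$; $Q_s(x)=sQ(x)+\frac{1-s}{d}\mathbb 1$; $Q$ and $P$ are mutually unbiased if $\mathrm{tr}(Q(x)P(y))=\frac1d$ for all $x,y$; $I_r(\rho)=r\rho+\frac{1-r}{d}\mathrm{tr}(\rho)\mathbb 1$. Put $a(r)=\frac{1}{\sqrt d}\big[\sqrt{r(d-1)+1}-\sqrt{1-r}\big]$ for $r\in[m_1,1]$. Fix a sharp meter $Q$. Below, $P$ denotes any sharp meter mutually unbiased with $Q$. Let $\mathrm{ECR}(Q,P)$ be the set of $(s,t)\in[m_1,1]^2$ such that $Q_s$ and $P_t$ have a joint meter. Let $\mathrm{ECR}(I,I)$ be the set of $(s,t)\in[m_2,1]^2$ for which there is a channel $\Gamma:L(\mathbb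 C^d)\to L(\mathbb C^d\otimes\mathbb C^d)$ with $I_s$ and $I_t$ as its two marginals. Let $\mathrm{Seq}(Q)$ be the set of $(s,t)\in[m_1,1]^2$ for which there is one instrument $\mathcal J$ such that $(x,y)\mapsto\mathcal J^\dagger(x,P(y))$ is a joint meter for $Q_s$ and $P_t$ for every such $P$. Let $\mathcal J_L^{(s)}(x,\rho)=Q_s(x)^{1/2}\rho\,Q_s(x)^{1/2}$ be the Lüders instrument. For channels $\Pi(\cdot|x)$ on $L(\mathbb C^d)$ let $\mathcal J^{(s)}_{L,\Pi}(x,\rho)=\Pi(\mathcal J_L^{(s)}(x,\rho)|x)$, and let $R(\rho|x)=(\mathbb 1-2Q(x))\rho(\mathbb 1-2Q(x))$. Then: 1. For $s\in[m_1,1]$, $\mathcal J_L^{(s)}$ is an instrument with $\mathcal J_L^{(s)\dagger}(\cdot,\mathbb 1)=Q_s$; each $R(\cdot|x)$ is a channel. 2. For $s\in[m_1,1]$ and every $P$, $G^{(s)}(x,y)=Q_s(x)^{1/2}P(y)Q_s(x)^{1/2}$ is a joint meter for $Q_s$ and $P_{1-a(s)^2}$, and $\mathcal J_L^{(s)\dagger}(x,P(y))=G^{(s)}(x,y)$.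 3. For $t\in[m_1,1]$ put $s=1-a(t)^2$. Then $s\in[0,1]$, and for every $P$ the meter $\tilde G^{(t)}(x,y)=P_t(y)^{1/2}Q(x)P_t(y)^{1/2}$ is a joint meter for $Q_s$ and $P_t$, equal to $\mathcal J_L^{(s)\dagger}(x,P(y))$ if $t\ge0$ and to $\mathcal J_{L,R}^{(s)\dagger}(x,P(y))$ if $t<0$. 4. If $d=2$, then for $s\in[-1,1]$ and every $P$, $G^{(s)}_-(x,y)=Q_s(x)^{1/2}P_{-1}(y)Q_s(x)^{1/2}$ is a joint meter for $Q_s$ and $P_{-(1-a(s)^2)}$, and $\mathcal J_{L,R}^{(s)\dagger}(x,P(y))=G_-^{(s)}(x,y)$. 5. If $d\ge3$, there are channels $\Pi(\cdot|x)$, not depending on $P$, such that for every $P$ $$G_{\mathrm{corner}}(x,y)=\tfrac{1}{d(d-2)}\Big[\mathbb 1-\tfrac{d}{d-1}\big(Q(x)-P(y)\big)^2\Big]$$ is a joint meter for $Q_{m_1}$ and $P_{m_1}$, and $\mathcal J_{L,\Pi}^{(m_1)\dagger}(x,P(y))=G_{\mathrm{corner}}(x,y)$. 6. These meters are the optimal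 ones: for every $P$, the extreme points of $\mathrm{ECR}(Q,P)$ are exactly the $(s,t)\in[m_1,1]^2$ with $t=1-a(s)^2$, or $s=1-a(t)^2$, or ($d=2$ and $t=-(1-a(s)^2)$), or ($d\ge3$ and $s=t=m_1$). Consequently, for every extreme point $(s,t)$ there are channels $\Pi(\cdot|x)$ such that $(x,y)\mapsto\mathcal J_{L,\Pi}^{(s)\dagger}(x,P'(y))$ is a joint meter for $Q_s$ and $P'_t$ for all sharp $P'$ mutually unbiased with $Q$. 7. $\mathrm{Seq}(Q)=\mathrm{ECR}(Q,P)$ for every $P$. 8. The sequential strategy strictly beats cloning: $\mathrm{ECR}(I,I)\subsetneq\mathrm{Seq}(Q)$; moreover, for every $s\in[m_2,1]\setminus\{0,1\}$ the point $(s,1-a(s)^2)$ lies in $\mathrm{Seq}(Q)$ but not in $\mathrm{ECR}(I,I)$. -/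

import Mathlib

open Matrix Set
open scoped MatrixOrder ComplexOrder

noncomputable section

/-! ### Meters, channels, instruments on finite-dimensional systems -/

/-- A meter (POVM) with outcomes in the finite set `X`. -/
def IsMeter {X n : Type*} [Fintype X] [Fintype n] [DecidableEq n]
    (M : X → Matrix n n ℂ) : Prop :=
  (∀ x, (M x).PosSemidef) ∧ ∑ x, M x = 1

/-- `G` is a joint meter for `M` and `N`. -/
def IsJointMeter {X Y n : Type*} [Fintype X] [Fintype Y] [Fintype n] [DecidableEq n]
    (G : X × Y → Matrix n n ℂ) (M : X → Matrix n n ℂ) (N : Y → Matrix n n ℂ) : Prop :=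
  IsMeter G ∧ (∀ x, ∑ y, G (x, y) = M x) ∧ (∀ y, ∑ x, G (x, y) = N y)

def MetersCompatible {X Y n : Type*} [Fintype X] [Fintype Y] [Fintype n] [DecidableEq n]
    (M : X → Matrix n n ℂ) (N : Y → Matrix n n ℂ) : Prop :=
  ∃ G : X × Y → Matrix n n ℂ, IsJointMeter G M N

/-- The map `id_k ⊗ Φ`, applied to a `k × k` block matrix with blocks indexed by `n`. -/
def ampliation {n m : Type*} (k : ℕ) (Φ : Matrix n n ℂ →ₗ[ℂ] Matrix m m ℂ)
    (A : Matrix (Fin k × n) (Fin k × n) ℂ) : Matrix (Fin k × m) (Fin k × m) ℂ :=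
  Matrix.of fun p q => Φ (Matrix.of fun i j => A (p.1, i) (q.1, j)) p.2 q.2

/-- Complete positivity of a linear map between matrix algebras. -/
def IsCP {n m : Type*} [Fintype n] [Fintype m] (Φ : Matrix n n ℂ →ₗ[ℂ] Matrix m m ℂ) : Prop :=
  ∀ (k : ℕ) (A : Matrix (Fin k × n) (Fin k × n) ℂ), A.PosSemidef → (ampliation k Φ A).PosSemidef

/-- A channel in the Schrödinger picture: completely positive and trace preserving. -/
def IsChannel {n m : Type*} [Fintype n] [Fintype m]
    (Φ : Matrix n n ℂ →ₗ[ℂ] Matrix m m ℂ) : Prop :=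
  IsCP Φ ∧ ∀ ρ, (Φ ρ).trace = ρ.trace

/-- An instrument in the Schrödinger picture. -/
def IsInstrument {X n m : Type*} [Fintype X] [Fintype n] [Fintype m]
    (J : X → Matrix n n ℂ →ₗ[ℂ] Matrix m m ℂ) : Prop :=
  (∀ x, IsCP (J x)) ∧ IsChannel (∑ x, J x)

/-- The Heisenberg-picture adjoint, characterized by `tr (ρ Φ†(A)) = tr (Φ(ρ) A)`. -/
def adjointMap {n m : Type*} [Fintype m] [DecidableEq n]
    (Φ : Matrix n n ℂ →ₗ[ℂ] Matrix m m ℂ) (A : Matrix m m ℂ) : Matrix n n ℂ :=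
  Matrix.of fun i j => (Φ (Matrix.single j i 1) * A).trace

theorem trace_mul_adjointMap {n m : Type*} [Fintype n] [Fintype m] [DecidableEq n]
    (Φ : Matrix n n ℂ →ₗ[ℂ] Matrix m m ℂ) (A : Matrix m m ℂ) (ρ : Matrix n n ℂ) :
    (ρ * adjointMap Φ A).trace = (Φ ρ * A).trace := by
  conv_rhs => rw [Matrix.matrix_eq_sum_single ρ]
  simp only [map_sum, Finset.sum_mul, Matrix.trace_sum]
  rw [Matrix.trace]
  refine Finset.sum_congr rfl fun i _ => ?_
  rw [Matrix.diag_apply, Matrix.mul_apply]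
  refine Finset.sum_congr rfl fun j _ => ?_
  have h : Matrix.single i j (ρ i j) = ρ i j • Matrix.single i j (1 : ℂ) := by
    rw [Matrix.smul_single, smul_eq_mul, mul_one]
  rw [h, map_smul, Matrix.smul_mul, Matrix.trace_smul, smul_eq_mul]
  rfl

/-- The meter obtained by applying the instrument `J` and then measuring the meter `N`:
`(x, y) ↦ J†(x, N(y))`. -/
def seqMeter {X Y n : Type*} [Fintype n] [DecidableEq n]
    (J : X → Matrix n n ℂ →ₗ[ℂ] Matrix n n ℂ) (N : Y → Matrix n n ℂ) :
    X × Y → Matrix n n ℂ :=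
  fun p => adjointMap (J p.1) (N p.2)

/-! ### Sharp meters, uniform noise, depolarizing channels -/

/-- The sharp meter `x ↦ |φ_x⟩⟨φ_x|` of an orthonormal basis. -/
def sharpMeter {d : ℕ} (φ : OrthonormalBasis (Fin d) ℂ (EuclideanSpace ℂ (Fin d))) :
    Fin d → Matrix (Fin d) (Fin d) ℂ :=
  fun x => Matrix.vecMulVec (φ x).ofLp (star (φ x).ofLp)

def MutuallyUnbiased {d : ℕ} (Q P : Fin d → Matrix (Fin d) (Fin d) ℂ) : Prop :=
  ∀ x y, (Q x * P y).trace = 1 / (d : ℂ)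

/-- `M_s(x) = s M(x) + (1 - s) 1 / d`. -/
def noisy {d : ℕ} (s : ℝ) (M : Fin d → Matrix (Fin d) (Fin d) ℂ) :
    Fin d → Matrix (Fin d) (Fin d) ℂ :=
  fun x => s • M x + ((1 - s) / d) • (1 : Matrix (Fin d) (Fin d) ℂ)

/-- `m_k = -1 / (d ^ k - 1)`, the least admissible noise parameter of sharp meters (`k = 1`)
and of depolarizing channels (`k = 2`). -/
def minNoise (d k : ℕ) : ℝ := -1 / ((d : ℝ) ^ k - 1)

/-- `I_r(ρ) = r ρ + (1 - r) tr(ρ) 1 / d`. -/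
def depolarize {d : ℕ} (r : ℝ) (ρ : Matrix (Fin d) (Fin d) ℂ) : Matrix (Fin d) (Fin d) ℂ :=
  r • ρ + ((1 - r) / d) • (ρ.trace • (1 : Matrix (Fin d) (Fin d) ℂ))

/-- The first clone: partial trace over the second tensor factor. -/
def firstMarginal {n m : Type*} [Fintype m] (A : Matrix (n × m) (n × m) ℂ) : Matrix n n ℂ :=
  Matrix.of fun i j => ∑ k, A (i, k) (j, k)

/-- The second clone: partial trace over the first tensor factor. -/
def secondMarginal {n m : Type*} [Fintype n] (A : Matrix (n × m) (n × m) ℂ) : Matrix m m ℂ :=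
  Matrix.of fun i j => ∑ k, A (k, i) (k, j)

/-! ### The regions of achievable noise parameters, for the three strategies -/

/-- `ECR(Q,P)`: the admissible `(s,t)` such that `Q_s` and `P_t` are compatible. -/
def jointRegion {d : ℕ} (Q P : Fin d → Matrix (Fin d) (Fin d) ℂ) : Set (ℝ × ℝ) :=
  {p | p.1 ∈ Icc (minNoise d 1) 1 ∧ p.2 ∈ Icc (minNoise d 1) 1 ∧
    MetersCompatible (noisy p.1 Q) (noisy p.2 P)}

/-- `ECR(I,I)`: the admissible `(s,t)` such that `I_s` and `I_t` have a joint channel. -/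
def cloningRegion (d : ℕ) : Set (ℝ × ℝ) :=
  {p | p.1 ∈ Icc (minNoise d 2) 1 ∧ p.2 ∈ Icc (minNoise d 2) 1 ∧
    ∃ Γ : Matrix (Fin d) (Fin d) ℂ →ₗ[ℂ] Matrix (Fin d × Fin d) (Fin d × Fin d) ℂ,
      IsChannel Γ ∧ (∀ ρ, firstMarginal (Γ ρ) = depolarize p.1 ρ) ∧
        (∀ ρ, secondMarginal (Γ ρ) = depolarize p.2 ρ)}

/-- The sequential region of `Q`: the admissible `(s,t)` for which one instrument, chosen in
advance, followed by a measurement of `P`, is a joint measurement of `Q_s` and `P_t` for every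
sharp meter `P` that is unbiased with respect to `Q`. -/
def sequentialRegion {d : ℕ} (Q : Fin d → Matrix (Fin d) (Fin d) ℂ) : Set (ℝ × ℝ) :=
  {p | p.1 ∈ Icc (minNoise d 1) 1 ∧ p.2 ∈ Icc (minNoise d 1) 1 ∧
    ∃ J : Fin d → Matrix (Fin d) (Fin d) ℂ →ₗ[ℂ] Matrix (Fin d) (Fin d) ℂ,
      IsInstrument J ∧
      ∀ ψ : OrthonormalBasis (Fin d) ℂ (EuclideanSpace ℂ (Fin d)),
        MutuallyUnbiased Q (sharpMeter ψ) →
          IsJointMeter (seqMeter J (sharpMeter ψ)) (noisy p.1 Q) (noisy p.2 (sharpMeter ψ))}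

/-! ### The Lüders instrument, conditional post-processing, and the optimal joint meters -/

/-- The Lüders instrument `ρ ↦ Q_s(x)^{1/2} ρ Q_s(x)^{1/2}`. -/
def luders {d : ℕ} (Q : Fin d → Matrix (Fin d) (Fin d) ℂ) (s : ℝ) (x : Fin d) :
    Matrix (Fin d) (Fin d) ℂ →ₗ[ℂ] Matrix (Fin d) (Fin d) ℂ :=
  LinearMap.mulLeftRight ℂ (CFC.sqrt (noisy s Q x), CFC.sqrt (noisy s Q x))

/-- The Lüders instrument, followed by the channel `C x` conditionally on the outcome `x`. -/
def ludersThen {d : ℕ} (Q : Fin d → Matrix (Fin d) (Fin d) ℂ) (s : ℝ)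
    (C : Fin d → Matrix (Fin d) (Fin d) ℂ →ₗ[ℂ] Matrix (Fin d) (Fin d) ℂ) (x : Fin d) :
    Matrix (Fin d) (Fin d) ℂ →ₗ[ℂ] Matrix (Fin d) (Fin d) ℂ :=
  C x ∘ₗ luders Q s x

/-- The conditional unitary channel `ρ ↦ (1 - 2 Q(x)) ρ (1 - 2 Q(x))`. -/
def reflection {d : ℕ} (Q : Fin d → Matrix (Fin d) (Fin d) ℂ) (x : Fin d) :
    Matrix (Fin d) (Fin d) ℂ →ₗ[ℂ] Matrix (Fin d) (Fin d) ℂ :=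
  LinearMap.mulLeftRight ℂ (1 - (2 : ℝ) • Q x, 1 - (2 : ℝ) • Q x)

/-- `a(r) = (√(r (d - 1) + 1) - √(1 - r)) / √d`. -/
def noiseA (d : ℕ) (r : ℝ) : ℝ :=
  (√(r * ((d : ℝ) - 1) + 1) - √(1 - r)) / √(d : ℝ)

/-- `G^(s)(x,y) = Q_s(x)^{1/2} P(y) Q_s(x)^{1/2}`. -/
def optG {d : ℕ} (Q P : Fin d → Matrix (Fin d) (Fin d) ℂ) (s : ℝ) :
    Fin d × Fin d → Matrix (Fin d) (Fin d) ℂ :=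
  fun p => CFC.sqrt (noisy s Q p.1) * P p.2 * CFC.sqrt (noisy s Q p.1)

/-- `G̃^(t)(x,y) = P_t(y)^{1/2} Q(x) P_t(y)^{1/2}`. -/
def optGTilde {d : ℕ} (Q P : Fin d → Matrix (Fin d) (Fin d) ℂ) (t : ℝ) :
    Fin d × Fin d → Matrix (Fin d) (Fin d) ℂ :=
  fun p => CFC.sqrt (noisy t P p.2) * Q p.1 * CFC.sqrt (noisy t P p.2)

/-- `G_-^(s)(x,y) = Q_s(x)^{1/2} P_{-1}(y) Q_s(x)^{1/2}`, used in dimension two. -/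
def optGMinus {d : ℕ} (Q P : Fin d → Matrix (Fin d) (Fin d) ℂ) (s : ℝ) :
    Fin d × Fin d → Matrix (Fin d) (Fin d) ℂ :=
  fun p => CFC.sqrt (noisy s Q p.1) * noisy (-1) P p.2 * CFC.sqrt (noisy s Q p.1)

/-- `G_corner(x,y) = (1 - d / (d - 1) (Q(x) - P(y))²) / (d (d - 2))`, used for `d ≥ 3`. -/
def optGCorner {d : ℕ} (Q P : Fin d → Matrix (Fin d) (Fin d) ℂ) :
    Fin d × Fin d → Matrix (Fin d) (Fin d) ℂ :=
  fun p => (1 / ((d : ℝ) * ((d : ℝ) - 2))) •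
    ((1 : Matrix (Fin d) (Fin d) ℂ) - ((d : ℝ) / ((d : ℝ) - 1)) • (Q p.1 - P p.2) ^ 2)

end

/-! Everything rests on `sqrt_noisy`: the square root of `Q_s(x)` is `w 1 + a Q(x)` with `w =
√((1-s)/d)` and `a = a(s)`, where `d w² + 2aw + a² = 1` because `Q_s(x)` has trace one. Unbiasedness
enters only through `Q P Q = Q/d` and `P Q P = P/d`. Summing `Q_s(x)^{1/2} P(y) Q_s(x)^{1/2}` over
`x` therefore leaves `(1 - a²) P(y) + (a²/d) 1`, which is the achievability half
(`isJointMeter_optG`). The remaining optimal meters come from exchanging `Q` and `P`, from a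
reflection that changes the root of the quadratic, and from a Schur multiplier at the corner.

The converse is an operator inequality. If projections satisfy `QPQ = cQ` and `PQP = cP` with `c <
1`, then `P ≤ (1+k) c Q + (1+1/k)(1-c)(1-Q)` for every `k > 0` (`posSemidef_of_sandwich`). Pairing
it with a joint meter and optimizing over `k` gives exactly `t ≤ 1 - a(s)²`
(`le_tradeoff_of_projections`), and by symmetry `s ≤ 1 - a(t)²`.

These inequalities, with one more when `d = 2`, cut out `tradeoffRegion`, which lies in the convex
hull of the optimal parameters. Mixing instruments makes the sequential region convex, so there is a
closed chain: trade-off region ⊆ hull ⊆ sequential region ⊆ joint region ⊆ trade-off region. Strict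
concavity of `1 - a²` shows that the optimal parameters are extreme, and a convex hull has no
extreme points outside its generating set.

For cloning the same operator inequality is applied to the Choi matrix and to the two projections
onto "input maximally entangled with one clone", for which `c = 1/d²`. This gives the trade-off of
dimension `d²`, which is strictly worse than that of dimension `d` except at noise parameters 0 and
1 (`noiseA_sq_lt`). -/

/-! ### The noise trade-off function -/

theorem minNoise_one_bounds {d : ℕ} (hd : 2 ≤ d) {r : ℝ} (hr : r ∈ Icc (minNoise d 1) 1) :
    0 ≤ r * ((d : ℝ) - 1) + 1 ∧ 0 ≤ 1 - r := by
  have hd' : (2 : ℝ) ≤ d := by exact_mod_cast hd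
  have h1 : minNoise d 1 * ((d : ℝ) - 1) = -1 := by
    rw [minNoise, pow_one, div_mul_cancel₀]; linarith
  have := mul_le_mul_of_nonneg_right hr.1 (by linarith : (0 : ℝ) ≤ (d : ℝ) - 1)
  constructor <;> linarith [hr.2]

/-- With `w = √((1-r)/d)`, the future root `w 1 + a Q(x)` has eigenvalue `w + a` once and `w` with
multiplicity `d - 1`. The equation is `tr Q_r(x) = 1`, and the inequality is positivity of the root.
-/
theorem noiseA_spec {d : ℕ} (hd : 2 ≤ d) {r : ℝ} (hr : r ∈ Icc (minNoise d 1) 1) :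
    (d : ℝ) * √((1 - r) / d) ^ 2 + 2 * noiseA d r * √((1 - r) / d) + noiseA d r ^ 2 = 1 ∧
      0 ≤ √((1 - r) / d) + noiseA d r := by
  have hd0 : (0 : ℝ) < d := by exact_mod_cast (by omega : 0 < d)
  obtain ⟨h1, h2⟩ := minNoise_one_bounds hd hr
  have hw : √((1 - r) / d) = √(1 - r) / √d := Real.sqrt_div h2 _
  have hs : √(d : ℝ) ≠ 0 := (Real.sqrt_pos.2 hd0).ne'
  have hd2 := Real.sq_sqrt hd0.le
  have e1 := Real.sq_sqrt h1
  have e2 := Real.sq_sqrt h2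
  rw [hw, noiseA]
  constructor
  · field_simp
    rw [hd2]
    linear_combination e1 + ((d : ℝ) - 1) * e2
  · rw [← add_div]
    exact div_nonneg (by linarith [Real.sqrt_nonneg (r * ((d : ℝ) - 1) + 1)]) (Real.sqrt_nonneg _)

theorem sqrt_noise_sq {d : ℕ} (hd : 2 ≤ d) {r : ℝ} (hr : r ∈ Icc (minNoise d 1) 1) :
    √((1 - r) / d) ^ 2 = (1 - r) / d :=
  Real.sq_sqrt (div_nonneg (minNoise_one_bounds hd hr).2 (Nat.cast_nonneg d))

/-- The quadratic equation and the sign condition of `noiseA_spec` determine `noiseA`. -/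
theorem eq_noiseA {d : ℕ} (hd : 2 ≤ d) {r b : ℝ} (hr : r ∈ Icc (minNoise d 1) 1)
    (h : (d : ℝ) * √((1 - r) / d) ^ 2 + 2 * b * √((1 - r) / d) + b ^ 2 = 1)
    (h0 : 0 ≤ √((1 - r) / d) + b) : b = noiseA d r := by
  obtain ⟨h1, h2⟩ := noiseA_spec hd hr
  have : (√((1 - r) / d) + b) ^ 2 = (√((1 - r) / d) + noiseA d r) ^ 2 := by
    linear_combination h - h1
  have := (pow_left_inj₀ h0 h2 two_ne_zero).1 this
  linarith

theorem minNoise_one_neg {d : ℕ} (hd : 2 ≤ d) : minNoise d 1 < 0 := by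
  have hd' : (2 : ℝ) ≤ d := by exact_mod_cast hd
  rw [minNoise, pow_one]
  exact div_neg_of_neg_of_pos (by norm_num) (by linarith)

theorem noiseA_sq_le_one {d : ℕ} (hd : 2 ≤ d) {r : ℝ} (hr : r ∈ Icc (minNoise d 1) 1) :
    noiseA d r ^ 2 ≤ 1 := by
  have hd' : (2 : ℝ) ≤ d := by exact_mod_cast hd
  obtain ⟨h1, h2⟩ := noiseA_spec hd hr
  have hw := Real.sqrt_nonneg ((1 - r) / d)
  set w := √((1 - r) / d)
  nlinarith [mul_nonneg hw h2, mul_nonneg (by linarith : (0 : ℝ) ≤ d - 2) (sq_nonneg w)]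

theorem tradeoff_mem_unit {d : ℕ} (hd : 2 ≤ d) {r : ℝ} (hr : r ∈ Icc (minNoise d 1) 1) :
    1 - noiseA d r ^ 2 ∈ Icc (0 : ℝ) 1 :=
  ⟨by linarith [noiseA_sq_le_one hd hr], by linarith [sq_nonneg (noiseA d r)]⟩

theorem tradeoff_mem {d : ℕ} (hd : 2 ≤ d) {r : ℝ} (hr : r ∈ Icc (minNoise d 1) 1) :
    1 - noiseA d r ^ 2 ∈ Icc (minNoise d 1) 1 :=
  ⟨(minNoise_one_neg hd).le.trans (tradeoff_mem_unit hd hr).1, (tradeoff_mem_unit hd hr).2⟩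

theorem noiseA_zero (d : ℕ) : noiseA d 0 = 0 := by simp [noiseA]

theorem noiseA_one {d : ℕ} (hd : 2 ≤ d) : noiseA d 1 = 1 := by
  have : √(d : ℝ) ≠ 0 := (Real.sqrt_pos.2 (by exact_mod_cast (by omega : 0 < d))).ne'
  simp [noiseA, this]

theorem noiseA_sign {d : ℕ} (hd : 2 ≤ d) {r : ℝ} :
    (0 ≤ r → 0 ≤ noiseA d r) ∧ (r ≤ 0 → noiseA d r ≤ 0) := by
  have hd' : (2 : ℝ) ≤ d := by exact_mod_cast hd
  refine ⟨fun h => div_nonneg (sub_nonneg.2 (Real.sqrt_le_sqrt ?_)) (Real.sqrt_nonneg _),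
    fun h => div_nonpos_of_nonpos_of_nonneg (sub_nonpos.2 (Real.sqrt_le_sqrt ?_))
      (Real.sqrt_nonneg _)⟩ <;> nlinarith

theorem sqrt_tradeoff {d : ℕ} (r : ℝ) :
    √((1 - (1 - noiseA d r ^ 2)) / d) = |noiseA d r| / √d := by
  rw [sub_sub_cancel, Real.sqrt_div (sq_nonneg _), Real.sqrt_sq_eq_abs]

/-- `a(1 - a(t)²) = √(1 - t)` for `t ≥ 0`. -/
theorem noiseA_tradeoff_of_nonneg {d : ℕ} (hd : 2 ≤ d) {t : ℝ} (ht : t ∈ Icc (minNoise d 1) 1)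
    (h0 : 0 ≤ t) : noiseA d (1 - noiseA d t ^ 2) = √(d : ℝ) * √((1 - t) / d) := by
  have hd0 : (0 : ℝ) < d := by exact_mod_cast (by omega : 0 < d)
  have hs := Real.sqrt_pos.2 hd0
  have hd2 := Real.sq_sqrt hd0.le
  symm
  have h := (noiseA_spec hd ht).1
  have hb := (noiseA_sign hd (r := t)).1 h0
  refine eq_noiseA hd (tradeoff_mem hd ht) ?_ ?_
  -- Passing from `t` to `1 - a(t)²` exchanges `w` and `a` up to factors `√d`; the quadratic is
  -- invariant under this exchange.
  · rw [sqrt_tradeoff, abs_of_nonneg hb, div_pow, mul_pow, hd2]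
    refine Eq.trans ?_ h
    field_simp
    ring
  · positivity

/-- `a(1 - a(t)²) = √(1 - t) - 2 |a(t)| / √d` for `t ≤ 0`. -/
theorem noiseA_tradeoff_of_nonpos {d : ℕ} (hd : 2 ≤ d) {t : ℝ} (ht : t ∈ Icc (minNoise d 1) 1)
    (h0 : t ≤ 0) : noiseA d (1 - noiseA d t ^ 2)
      = √(d : ℝ) * √((1 - t) / d) + 2 * noiseA d t / √d := by
  have hd0 : (0 : ℝ) < d := by exact_mod_cast (by omega : 0 < d)
  have hd' : (2 : ℝ) ≤ d := by exact_mod_cast hd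
  have hs := Real.sqrt_pos.2 hd0
  have hd2 := Real.sq_sqrt hd0.le
  symm
  obtain ⟨h, h3⟩ := noiseA_spec hd ht
  have hb := (noiseA_sign hd (r := t)).2 h0
  have hw := Real.sqrt_nonneg ((1 - t) / d)
  refine eq_noiseA hd (tradeoff_mem hd ht) ?_ ?_
  · rw [sqrt_tradeoff, abs_of_nonpos hb, div_pow, neg_sq, hd2]
    refine Eq.trans ?_ h
    field_simp
    rw [hd2]
    ring
  · rw [sqrt_tradeoff, abs_of_nonpos hb]
    set w := √((1 - t) / d)
    have : -noiseA d t / √d + (√(d : ℝ) * w + 2 * noiseA d t / √d)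
        = ((d : ℝ) * w + noiseA d t) / √d := by
      field_simp; rw [hd2]; ring
    rw [this]
    apply div_nonneg _ hs.le
    nlinarith

theorem noiseA_minNoise {d : ℕ} (hd : 2 ≤ d) :
    1 - noiseA d (minNoise d 1) ^ 2 = ((d : ℝ) - 2) / (d - 1) := by
  have hd' : (2 : ℝ) ≤ d := by exact_mod_cast hd
  have h1 : minNoise d 1 * ((d : ℝ) - 1) + 1 = 0 := by
    rw [minNoise, pow_one, div_mul_cancel₀] <;> linarith
  have h2 : 1 - minNoise d 1 = d / (d - 1) := by
    have : (d : ℝ) - 1 ≠ 0 := by linarith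
    rw [minNoise, pow_one]; field_simp; ring
  have h3 : (0 : ℝ) < d - 1 := by linarith
  rw [noiseA, h1, h2, Real.sqrt_zero, zero_sub, div_pow, neg_sq, 
    Real.sq_sqrt (div_nonneg (by linarith) h3.le), Real.sq_sqrt (by positivity)]
  field_simp
  ring

/-- An affine function plus a geometric mean of two affine functions: the form in which strict
concavity is visible. -/
theorem tradeoff_eq {d : ℕ} (hd : 2 ≤ d) {r : ℝ} (hr : r ∈ Icc (minNoise d 1) 1) :
    1 - noiseA d r ^ 2 = ((d : ℝ) - 2) / d * (1 - r)
      + 2 / d * (√(r * ((d : ℝ) - 1) + 1) * √(1 - r)) := by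
  have hd0 : (0 : ℝ) < d := by exact_mod_cast (by omega : 0 < d)
  obtain ⟨h1, h2⟩ := minNoise_one_bounds hd hr
  have e1 := Real.sq_sqrt h1
  have e2 := Real.sq_sqrt h2
  rw [noiseA, div_pow, Real.sq_sqrt hd0.le]
  field_simp
  linear_combination -e1 - e2

theorem strictConcaveOn_tradeoff {d : ℕ} (hd : 2 ≤ d) :
    StrictConcaveOn ℝ (Icc (minNoise d 1) 1) fun r => 1 - noiseA d r ^ 2 := by
  have hd0 : (0 : ℝ) < d := by exact_mod_cast (by omega : 0 < d)
  refine ⟨convex_Icc _ _, fun x hx y hy hxy α β hα hβ hab => ?_⟩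
  have hz := convex_Icc (minNoise d 1) 1 hx hy hα.le hβ.le hab
  simp only [smul_eq_mul] at hz ⊢
  rw [tradeoff_eq hd hx, tradeoff_eq hd hy, tradeoff_eq hd hz]
  obtain ⟨a1, a2⟩ := minNoise_one_bounds hd hx
  obtain ⟨b1, b2⟩ := minNoise_one_bounds hd hy
  obtain ⟨c1, c2⟩ := minNoise_one_bounds hd hz
  have key : α * (√(x * ((d : ℝ) - 1) + 1) * √(1 - x)) + β * (√(y * ((d : ℝ) - 1) + 1) * √(1 - y))
      < √((α * x + β * y) * ((d : ℝ) - 1) + 1) * √(1 - (α * x + β * y)) := by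
    rw [← Real.sqrt_mul c1]
    apply Real.lt_sqrt_of_sq_lt
    have e1 := Real.sq_sqrt a1
    have e2 := Real.sq_sqrt a2
    have e3 := Real.sq_sqrt b1
    have e4 := Real.sq_sqrt b2
    set p := √(x * ((d : ℝ) - 1) + 1)
    set q := √(1 - x)
    set u := √(y * ((d : ℝ) - 1) + 1)
    set v := √(1 - y)
    have f1 : (α * x + β * y) * ((d : ℝ) - 1) + 1 = α * p ^ 2 + β * u ^ 2 := by
      rw [e1, e3]; linear_combination -hab
    have f2 : 1 - (α * x + β * y) = α * q ^ 2 + β * v ^ 2 := by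
      rw [e2, e4]; linear_combination -hab
    rw [f1, f2]
    -- This is the equality case of Cauchy–Schwarz for `(p, u)` and `(q, v)`; it would force `d (x -
    -- y) = 0`.
    have hne : p * v - q * u ≠ 0 := by
      intro h
      have h' : p ^ 2 * v ^ 2 = q ^ 2 * u ^ 2 := by
        linear_combination (p * v + q * u) * h
      rw [e1, e2, e3, e4] at h'
      have : (d : ℝ) * (x - y) = 0 := by linear_combination h'
      rcases mul_eq_zero.1 this with h | h
      · exact hd0.ne' h
      · exact hxy (sub_eq_zero.1 h)
    have := mul_pos (mul_pos hα hβ) (by positivity : 0 < (p * v - q * u) ^ 2)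
    linarith [show (α * p ^ 2 + β * u ^ 2) * (α * q ^ 2 + β * v ^ 2)
      = (α * (p * q) + β * (u * v)) ^ 2 + α * β * (p * v - q * u) ^ 2 by ring]
  have h2 : 0 < 2 / (d : ℝ) := by positivity
  have := mul_lt_mul_of_pos_left key h2
  have h3 : ((d : ℝ) - 2) / d * (1 - (α * x + β * y))
      = α * (((d : ℝ) - 2) / d * (1 - x)) + β * (((d : ℝ) - 2) / d * (1 - y)) := by
    linear_combination (-((d : ℝ) - 2) / d) * hab
  rw [h3]
  linarith

theorem tradeoff_two {r : ℝ} (hr : r ∈ Icc (minNoise 2 1) 1) :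
    1 - noiseA 2 r ^ 2 = √(1 - r ^ 2) := by
  have := (minNoise_one_bounds le_rfl hr).1
  rw [tradeoff_eq le_rfl hr, ← Real.sqrt_mul this]
  norm_num
  congr 1
  ring

theorem minNoise_two_one : minNoise 2 1 = -1 := by norm_num [minNoise]

theorem minNoise_two_eq (d : ℕ) : minNoise d 2 = minNoise (d ^ 2) 1 := by
  simp [minNoise]

theorem minNoise_one_le_two {d : ℕ} (hd : 2 ≤ d) : minNoise d 1 ≤ minNoise d 2 := by
  have hd' : (2 : ℝ) ≤ d := by exact_mod_cast hd
  rw [minNoise, minNoise, pow_one, neg_div, neg_div, neg_le_neg_iff]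
  exact one_div_le_one_div_of_le (by linarith) (by nlinarith)

/-- The trade-off function decreases strictly with the dimension, except at its fixed values. -/
theorem noiseA_sq_lt {d e : ℕ} (hd : 2 ≤ d) (hde : d < e) {r : ℝ}
    (hr : r ∈ Icc (minNoise d 1) 1) (hr' : r ∈ Icc (minNoise e 1) 1) (h0 : r ≠ 0) (h1 : r ≠ 1) :
    noiseA d r ^ 2 < noiseA e r ^ 2 := by
  -- Rationalization: `a` is the difference of these two roots, whose squares differ by `r`. Both
  -- radicands decrease with `n`, being `r + (1-r)/n` and `(1-r)/n`, so `|a|` must grow.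
  have key : ∀ {n : ℕ}, 2 ≤ n → r ∈ Icc (minNoise n 1) 1 →
      noiseA n r * (√((r * ((n : ℝ) - 1) + 1) / n) + √((1 - r) / n)) = r := by
    intro n hn hrn
    obtain ⟨b1, b2⟩ := minNoise_one_bounds hn hrn
    have hn0 : (0 : ℝ) < n := by exact_mod_cast (by omega : 0 < n)
    have hs : √(n : ℝ) ≠ 0 := (Real.sqrt_pos.2 hn0).ne'
    rw [noiseA, Real.sqrt_div b1, Real.sqrt_div b2]
    field_simp
    rw [Real.sq_sqrt hn0.le]
    linear_combination Real.sq_sqrt b1 - Real.sq_sqrt b2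
  have k1 := key hd hr
  have k2 := key (by omega) hr'
  have hd0 : (0 : ℝ) < d := by exact_mod_cast (by omega : 0 < d)
  have he0 : (0 : ℝ) < e := by exact_mod_cast (by omega : 0 < e)
  have hr1 : 0 < 1 - r := sub_pos.2 (lt_of_le_of_ne hr.2 h1)
  have hlt : (1 - r) / e < (1 - r) / d :=
    div_lt_div_of_pos_left hr1 hd0 (by exact_mod_cast hde)
  have hu : √((1 - r) / e) < √((1 - r) / d) := Real.sqrt_lt_sqrt (by positivity) hlt
  have hv : √((r * ((e : ℝ) - 1) + 1) / e) ≤ √((r * ((d : ℝ) - 1) + 1) / d) := by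
    apply Real.sqrt_le_sqrt
    rw [show (r * ((e : ℝ) - 1) + 1) / e = r + (1 - r) / e by field_simp; ring,
      show (r * ((d : ℝ) - 1) + 1) / d = r + (1 - r) / d by field_simp; ring]
    linarith
  have hue : 0 < √((1 - r) / e) := Real.sqrt_pos.2 (by positivity)
  have hve := Real.sqrt_nonneg ((r * ((e : ℝ) - 1) + 1) / e)
  set X := √((r * ((d : ℝ) - 1) + 1) / d) + √((1 - r) / d)
  set Y := √((r * ((e : ℝ) - 1) + 1) / e) + √((1 - r) / e)
  have hXY : Y < X := by simp only [X, Y]; linarith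
  have hY : 0 < Y := by simp only [Y]; linarith
  have hsq : Y ^ 2 < X ^ 2 := by nlinarith
  have e1 : noiseA d r ^ 2 * X ^ 2 = noiseA e r ^ 2 * Y ^ 2 := by
    rw [← mul_pow, ← mul_pow, k1, k2]
  have hne : 0 < noiseA d r ^ 2 := by
    have : noiseA d r ≠ 0 := by
      intro h; rw [h, zero_mul] at k1; exact h0 k1.symm
    positivity
  by_contra! hcon
  nlinarith [mul_lt_mul_of_pos_left hsq hne, mul_le_mul_of_nonneg_right hcon (sq_nonneg Y)]

/-- Optimizing a one-parameter family of linear bounds. -/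
theorem le_add_sq_of_forall_pos {z X Y : ℝ} (hX : 0 ≤ X) (hY : 0 ≤ Y)
    (h : ∀ k : ℝ, 0 < k → z ≤ (1 + k) * X ^ 2 + (1 + 1 / k) * Y ^ 2) : z ≤ (X + Y) ^ 2 := by
  apply le_of_forall_pos_le_add
  intro ε hε
  -- The optimal choice is `k = Y / X`; the shift by `δ` covers vanishing `X` or `Y`.
  obtain ⟨δ, hδ, hδε⟩ : ∃ δ : ℝ, 0 < δ ∧ δ * (X + Y) ≤ ε :=
    ⟨ε / (X + Y + 1), by positivity, by
      rw [div_mul_eq_mul_div, div_le_iff₀ (by positivity)]; nlinarith⟩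
  have h1 := h ((Y + δ) / (X + δ)) (by positivity)
  have h2 : (Y + δ) / (X + δ) * X ^ 2 ≤ (Y + δ) * X := by
    rw [div_mul_eq_mul_div, div_le_iff₀ (by positivity)]
    nlinarith [mul_nonneg (mul_nonneg (by positivity : 0 ≤ Y + δ) hX) hδ.le]
  have h3 : 1 / ((Y + δ) / (X + δ)) * Y ^ 2 ≤ (X + δ) * Y := by
    rw [one_div_div, div_mul_eq_mul_div, div_le_iff₀ (by positivity)]
    nlinarith [mul_nonneg (mul_nonneg (by positivity : 0 ≤ X + δ) hY) hδ.le]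
  linarith

theorem le_tradeoff {d : ℕ} (hd : 2 ≤ d) {s t : ℝ} (hs : s ∈ Icc (minNoise d 1) 1)
    (h : ∀ k : ℝ, 0 < k → (t * ((d : ℝ) - 1) + 1) / d ≤
      (1 + k) * (1 / d) * ((s * ((d : ℝ) - 1) + 1) / d)
        + (1 + 1 / k) * (1 - 1 / d) * (1 - (s * ((d : ℝ) - 1) + 1) / d)) :
    t ≤ 1 - noiseA d s ^ 2 := by
  have hd' : (2 : ℝ) ≤ d := by exact_mod_cast hd
  have hd0 : (0 : ℝ) < d := by linarith
  obtain ⟨h1, h2⟩ := noiseA_spec hd hs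
  have hw := Real.sqrt_nonneg ((1 - s) / d)
  have hw2 := sqrt_noise_sq hd hs
  have hsd := Real.sqrt_pos.2 hd0
  have hd2 := Real.sq_sqrt hd0.le
  set w := √((1 - s) / d)
  set a := noiseA d s
  have hs' : s = 1 - d * w ^ 2 := by rw [hw2]; field_simp; ring
  -- With `u = (w + a)²` and `1 - u = (d-1) w²`, these are the roots of `u/d` and `(1 - 1/d)(1 -
  -- u)`. Their sum is `(dw + a)/√d`, and the quadratic turns its square into `((1 - a²)(d-1) +
  -- 1)/d`.
  have key := le_add_sq_of_forall_pos (z := (t * ((d : ℝ) - 1) + 1) / d) (X := (w + a) / √d)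
    (Y := (d - 1) * w / √d) (by positivity)
    (div_nonneg (mul_nonneg (by linarith) hw) hsd.le) fun k hk => (h k hk).trans (le_of_eq ?_)
  · rw [← add_div, div_pow, hd2, div_le_div_iff_of_pos_right hd0] at key
    have : t * ((d : ℝ) - 1) ≤ (1 - a ^ 2) * ((d : ℝ) - 1) := by nlinarith
    exact le_of_mul_le_mul_right this (by linarith)
  · have e : (s * ((d : ℝ) - 1) + 1) / d = (w + a) ^ 2 := by
      rw [hs']; field_simp; linear_combination (d : ℝ) * (-h1)
    have e' : 1 - (s * ((d : ℝ) - 1) + 1) / d = (d - 1) * w ^ 2 := by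
      rw [e]; linear_combination -h1
    rw [e', e, div_pow, div_pow, hd2]
    field_simp

/-! ### The convex geometry of the trade-off -/

/-- The region cut out of the square of admissible parameters by the trade-off inequalities. -/
def tradeoffRegion (d : ℕ) : Set (ℝ × ℝ) :=
  {p | p.1 ∈ Icc (minNoise d 1) 1 ∧ p.2 ∈ Icc (minNoise d 1) 1 ∧
    p.2 ≤ 1 - noiseA d p.1 ^ 2 ∧ p.1 ≤ 1 - noiseA d p.2 ^ 2 ∧
      (d = 2 → -p.2 ≤ 1 - noiseA d p.1 ^ 2)}

/-- The parameters of the optimal joint meters. -/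
def optimalParameters (d : ℕ) : Set (ℝ × ℝ) :=
  {p : ℝ × ℝ | p.1 ∈ Icc (minNoise d 1) 1 ∧ p.2 ∈ Icc (minNoise d 1) 1 ∧
    (p.2 = 1 - noiseA d p.1 ^ 2 ∨
      p.1 = 1 - noiseA d p.2 ^ 2 ∨
      (d = 2 ∧ p.2 = -(1 - noiseA d p.1 ^ 2)) ∨
      (3 ≤ d ∧ p = (minNoise d 1, minNoise d 1)))}

theorem mem_of_mem_vertical {C : Set (ℝ × ℝ)} (hC : Convex ℝ C) {s t t₁ t₂ : ℝ}
    (h₁ : (s, t₁) ∈ C) (h₂ : (s, t₂) ∈ C) (h : t ∈ Icc t₁ t₂) : (s, t) ∈ C := by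
  apply hC.segment_subset h₁ h₂
  rw [← Prod.image_mk_segment_right, segment_eq_Icc (h.1.trans h.2)]
  exact ⟨t, h, rfl⟩

theorem mem_of_mem_horizontal {C : Set (ℝ × ℝ)} (hC : Convex ℝ C) {s t s₁ s₂ : ℝ}
    (h₁ : (s₁, t) ∈ C) (h₂ : (s₂, t) ∈ C) (h : s ∈ Icc s₁ s₂) : (s, t) ∈ C := by
  apply hC.segment_subset h₁ h₂
  rw [← Prod.image_mk_segment_left, segment_eq_Icc (h.1.trans h.2)]
  exact ⟨s, h, rfl⟩

theorem minNoise_one_mem {d : ℕ} (hd : 2 ≤ d) : minNoise d 1 ∈ Icc (minNoise d 1) 1 :=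
  ⟨le_rfl, (minNoise_one_neg hd).le.trans zero_le_one⟩

theorem zero_mem_params {d : ℕ} (hd : 2 ≤ d) : (0 : ℝ) ∈ Icc (minNoise d 1) 1 :=
  ⟨(minNoise_one_neg hd).le, zero_le_one⟩

theorem graph_mem_optimalParameters {d : ℕ} (hd : 2 ≤ d) {s : ℝ}
    (hs : s ∈ Icc (minNoise d 1) 1) : (s, 1 - noiseA d s ^ 2) ∈ optimalParameters d :=
  ⟨hs, tradeoff_mem hd hs, Or.inl rfl⟩

theorem graph_mem_optimalParameters' {d : ℕ} (hd : 2 ≤ d) {t : ℝ}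
    (ht : t ∈ Icc (minNoise d 1) 1) : (1 - noiseA d t ^ 2, t) ∈ optimalParameters d :=
  ⟨tradeoff_mem hd ht, ht, Or.inr (Or.inl rfl)⟩

theorem tradeoffRegion_subset_convexHull {d : ℕ} (hd : 2 ≤ d) :
    tradeoffRegion d ⊆ convexHull ℝ (optimalParameters d) := by
  rintro ⟨s, t⟩ ⟨hs, ht, h1, h2, h3⟩
  simp only at hs ht h1 h2 h3
  have hC := convex_convexHull ℝ (optimalParameters d)
  have hsub := subset_convexHull ℝ (optimalParameters d)
  have hup := hsub (graph_mem_optimalParameters hd hs)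
  rcases hd.eq_or_lt with rfl | hd3
  · have hlow : (s, -(1 - noiseA 2 s ^ 2)) ∈ optimalParameters 2 := by
      have := tradeoff_mem_unit hd hs
      refine ⟨hs, ?_, Or.inr (Or.inr (Or.inl ⟨rfl, rfl⟩))⟩
      rw [minNoise_two_one]
      exact ⟨neg_le_neg this.2, by linarith [this.1]⟩
    exact mem_of_mem_vertical hC (hsub hlow) hup ⟨by linarith [h3 rfl], h1⟩
  -- Let `s*` be the trade-off value at `m_1`. If `s ≤ s*`, the point lies above the bottom edge
  -- from the corner to `(s*, m_1)`; if `t ≤ s*`, it lies to the right of the left edge.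
  · have hm := minNoise_one_mem hd
    have hcorner : (minNoise d 1, minNoise d 1) ∈ optimalParameters d :=
      ⟨hm, hm, Or.inr (Or.inr (Or.inr ⟨hd3, rfl⟩))⟩
    have hU := (tradeoff_mem_unit hd hm).1
    by_cases hs1 : s ≤ 1 - noiseA d (minNoise d 1) ^ 2
    · have hlow := mem_of_mem_horizontal hC (hsub hcorner)
        (hsub (graph_mem_optimalParameters' hd hm)) ⟨hs.1, hs1⟩
      exact mem_of_mem_vertical hC hlow hup ⟨ht.1, h1⟩
    by_cases ht1 : t ≤ 1 - noiseA d (minNoise d 1) ^ 2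
    · have hleft := mem_of_mem_vertical hC (hsub hcorner)
        (hsub (graph_mem_optimalParameters hd hm)) ⟨ht.1, ht1⟩
      exact mem_of_mem_horizontal hC hleft (hsub (graph_mem_optimalParameters' hd ht)) ⟨hs.1, h2⟩
    push Not at hs1 ht1
    have hd3' : (3 : ℝ) ≤ d := by exact_mod_cast hd3
    -- In the remaining case both coordinates exceed `1/2`, so the point lies above the chord from
    -- `(1,0)` to `(0,1)`. Here `d ≥ 3` is needed.
    have hhalf : 1 / 2 ≤ 1 - noiseA d (minNoise d 1) ^ 2 := by
      rw [noiseA_minNoise hd, div_le_div_iff₀ (by norm_num) (by linarith)]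
      linarith
    have h01 : ((0 : ℝ), (1 : ℝ)) ∈ convexHull ℝ (optimalParameters d) := by
      have := hsub (graph_mem_optimalParameters hd (zero_mem_params hd))
      rwa [noiseA_zero, zero_pow two_ne_zero, sub_zero] at this
    have h10 : ((1 : ℝ), (0 : ℝ)) ∈ convexHull ℝ (optimalParameters d) := by
      have := hsub (graph_mem_optimalParameters' hd (zero_mem_params hd))
      rwa [noiseA_zero, zero_pow two_ne_zero, sub_zero] at this
    have hline : (s, 1 - s) ∈ convexHull ℝ (optimalParameters d) := by
      have := hC h10 h01 (by linarith : 0 ≤ s) (by linarith [hs.2] : 0 ≤ 1 - s) (by ring)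
      simpa using this
    exact mem_of_mem_vertical hC hline hup ⟨by linarith, h1⟩

/-- A point on the graph of a strictly concave function is not a proper convex combination of
points below the graph. -/
theorem StrictConcaveOn.eq_of_combo {S : Set ℝ} {f : ℝ → ℝ} (hf : StrictConcaveOn ℝ S f)
    {x y u v α β : ℝ} (hx : x ∈ S) (hy : y ∈ S) (hu : u ≤ f x) (hv : v ≤ f y)
    (hα : 0 < α) (hβ : 0 < β) (hab : α + β = 1) (h : α * u + β * v = f (α * x + β * y)) :
    x = y ∧ u = v := by
  have hxy : x = y := by
    by_contra hne
    have := hf.2 hx hy hne hα hβ hab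
    simp only [smul_eq_mul] at this
    nlinarith
  subst hxy
  rw [← add_mul, hab, one_mul] at h
  have e : α * f x + β * f x = f x := by rw [← add_mul, hab, one_mul]
  have e1 : u = f x := le_antisymm hu <| by
    by_contra! hc
    linarith [mul_lt_mul_of_pos_left hc hα, mul_le_mul_of_nonneg_left hv hβ.le]
  have e2 : v = f x := le_antisymm hv <| by
    by_contra! hc
    linarith [mul_lt_mul_of_pos_left hc hβ, mul_le_mul_of_nonneg_left hu hα.le]
  exact ⟨rfl, e1.trans e2.symm⟩

/-- Each curve is the graph of a strictly concave function bounding the region, over `s`, over `t`,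
or after `t ↦ -t`. The corner is extreme because both coordinates are minimal there. -/
theorem optimalParameters_extreme {d : ℕ} (hd : 2 ≤ d) {p : ℝ × ℝ}
    (hp : p ∈ optimalParameters d) (hpR : p ∈ tradeoffRegion d) :
    p ∈ extremePoints ℝ (tradeoffRegion d) := by
  have hU := strictConcaveOn_tradeoff hd
  rw [mem_extremePoints_iff_left]
  refine ⟨hpR, ?_⟩
  rintro ⟨s₁, t₁⟩ ⟨a1, a2, a3, a4, a5⟩ ⟨s₂, t₂⟩ ⟨b1, b2, b3, b4, b5⟩ ⟨α, β, hα, hβ, hab, rfl⟩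
  obtain ⟨-, -, h⟩ := hp
  simp only [Prod.smul_mk, Prod.mk_add_mk, smul_eq_mul, Prod.mk.injEq] at *
  suffices s₁ = s₂ ∧ t₁ = t₂ by
    obtain ⟨rfl, rfl⟩ := this
    rw [← add_mul, ← add_mul, hab, one_mul, one_mul]
    exact ⟨rfl, rfl⟩
  rcases h with h | h | ⟨h2, h⟩ | ⟨-, h, h'⟩
  · exact hU.eq_of_combo a1 b1 a3 b3 hα hβ hab h
  · exact (hU.eq_of_combo a2 b2 a4 b4 hα hβ hab h).symm
  · have := hU.eq_of_combo a1 b1 (a5 h2) (b5 h2) hα hβ hab (by linarith)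
    exact ⟨this.1, neg_injective this.2⟩
  · have hm : minNoise d 1 = α * minNoise d 1 + β * minNoise d 1 := by
      rw [← add_mul, hab, one_mul]
    have key : ∀ {x y : ℝ}, minNoise d 1 ≤ x → minNoise d 1 ≤ y →
        α * x + β * y = minNoise d 1 → x = y := by
      intro x y hx hy hxy
      have e1 : x = minNoise d 1 := le_antisymm (by by_contra! hc; nlinarith) hx
      have e2 : y = minNoise d 1 := le_antisymm (by by_contra! hc; nlinarith) hy
      rw [e1, e2]
    exact ⟨key a1.1 b1.1 h, key a2.1 b2.1 h'⟩

/-- The trade-off inequalities in dimension `d ^ 2` imply those in dimension `d`. -/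
theorem mem_tradeoffRegion_of_sq {d : ℕ} (hd : 2 ≤ d) {s t : ℝ}
    (hs : s ∈ Icc (minNoise d 2) 1) (ht : t ∈ Icc (minNoise d 2) 1)
    (h1 : t ≤ 1 - noiseA (d ^ 2) s ^ 2) (h2 : s ≤ 1 - noiseA (d ^ 2) t ^ 2) :
    (s, t) ∈ tradeoffRegion d := by
  have hd2 : d < d ^ 2 := by nlinarith
  have hle : ∀ {r : ℝ}, r ∈ Icc (minNoise d 2) 1 → noiseA d r ^ 2 ≤ noiseA (d ^ 2) r ^ 2 := by
    intro r hr
    by_cases h0 : r = 0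
    · rw [h0, noiseA_zero, noiseA_zero]
    by_cases h1 : r = 1
    · rw [h1, noiseA_one hd, noiseA_one (by omega)]
    exact (noiseA_sq_lt hd hd2 ⟨(minNoise_one_le_two hd).trans hr.1, hr.2⟩
      (minNoise_two_eq d ▸ hr) h0 h1).le
  have hs' : s ∈ Icc (minNoise d 1) 1 := ⟨(minNoise_one_le_two hd).trans hs.1, hs.2⟩
  have ht' : t ∈ Icc (minNoise d 1) 1 := ⟨(minNoise_one_le_two hd).trans ht.1, ht.2⟩
  have k1 := h1.trans (sub_le_sub_left (hle hs) 1)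
  have k2 := h2.trans (sub_le_sub_left (hle ht) 1)
  refine ⟨hs', ht', k1, k2, ?_⟩
  rintro rfl
  simp only
  rw [tradeoff_two ht'] at k2
  rw [tradeoff_two hs']
  have hm : minNoise 2 2 = -1 / 3 := by norm_num [minNoise]
  rw [hm] at hs ht
  obtain ⟨hs1, hs2⟩ := hs
  obtain ⟨ht1, ht2⟩ := ht
  apply Real.le_sqrt_of_sq_le
  -- The target is `s² + t² ≤ 1`. It follows by squaring the inequality that bounds a nonnegative
  -- coordinate; if both are negative, both are at least `-1/3`.
  rcases le_or_gt 0 s with h0 | h0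
  · have := (Real.le_sqrt h0 (by nlinarith)).1 k2
    linarith
  · rw [tradeoff_two hs'] at k1
    rcases le_or_gt 0 t with h0' | h0'
    · have := (Real.le_sqrt h0' (by nlinarith)).1 k1
      linarith
    · nlinarith

/-! ### Completely positive maps -/

section CP

variable {n m l : Type*} [Fintype n] [Fintype m] [Fintype l]

theorem IsCP.add {Φ Ψ : Matrix n n ℂ →ₗ[ℂ] Matrix m m ℂ} (hΦ : IsCP Φ) (hΨ : IsCP Ψ) :
    IsCP (Φ + Ψ) := fun k A hA => (hΦ k A hA).add (hΨ k A hA)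

theorem IsCP.zero : IsCP (0 : Matrix n n ℂ →ₗ[ℂ] Matrix m m ℂ) := fun k A _ => by
  have : ampliation k (0 : Matrix n n ℂ →ₗ[ℂ] Matrix m m ℂ) A = 0 := rfl
  rw [this]
  exact PosSemidef.zero

theorem IsCP.smul {Φ : Matrix n n ℂ →ₗ[ℂ] Matrix m m ℂ} (hΦ : IsCP Φ) {r : ℝ} (hr : 0 ≤ r) :
    IsCP (r • Φ) := fun k A hA => (hΦ k A hA).smul hr

theorem IsCP.sum {ι : Type*} {s : Finset ι} {Φ : ι → Matrix n n ℂ →ₗ[ℂ] Matrix m m ℂ}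
    (h : ∀ i ∈ s, IsCP (Φ i)) : IsCP (∑ i ∈ s, Φ i) :=
  Finset.sum_induction _ IsCP (fun _ _ => IsCP.add) IsCP.zero h

theorem IsCP.comp {Φ : Matrix n n ℂ →ₗ[ℂ] Matrix m m ℂ} {Ψ : Matrix m m ℂ →ₗ[ℂ] Matrix l l ℂ}
    (hΨ : IsCP Ψ) (hΦ : IsCP Φ) : IsCP (Ψ ∘ₗ Φ) := fun k A hA => hΨ k _ (hΦ k A hA)

/-- The ampliation is again a conjugation, by `1 ⊗ K`. -/
theorem IsCP.conj (K : Matrix n n ℂ) : IsCP (LinearMap.mulLeftRight ℂ (K, Kᴴ)) := by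
  classical
  intro k A hA
  have h : ampliation k (LinearMap.mulLeftRight ℂ (K, Kᴴ)) A
      = kroneckerMap (· * ·) (1 : Matrix (Fin k) (Fin k) ℂ) K * A
        * (kroneckerMap (· * ·) (1 : Matrix (Fin k) (Fin k) ℂ) K)ᴴ := by
    ext p q
    simp only [ampliation, LinearMap.mulLeftRight_apply, of_apply, mul_apply,
      Fintype.sum_prod_type, kroneckerMap_apply, one_apply, conjTranspose_apply, ite_mul, one_mul,
      zero_mul, Finset.sum_ite_irrel, Finset.sum_const_zero, Finset.sum_ite_eq,
      Finset.mem_univ, if_true, apply_ite star, star_zero, mul_ite, mul_zero]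
  rw [h]
  exact hA.mul_mul_conjTranspose_same _

theorem IsCP.conj_of_isHermitian {K : Matrix n n ℂ} (hK : Kᴴ = K) :
    IsCP (LinearMap.mulLeftRight ℂ (K, K)) := by
  have := IsCP.conj K
  rwa [hK] at this

theorem IsChannel.id : IsChannel (LinearMap.id : Matrix n n ℂ →ₗ[ℂ] Matrix n n ℂ) :=
  ⟨fun _ _ hA => hA, fun _ => rfl⟩

theorem IsInstrument.comp {X : Type*} [Fintype X] {J : X → Matrix n n ℂ →ₗ[ℂ] Matrix m m ℂ}
    {C : X → Matrix m m ℂ →ₗ[ℂ] Matrix l l ℂ} (hJ : IsInstrument J) (hC : ∀ x, IsChannel (C x)) :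
    IsInstrument fun x => C x ∘ₗ J x := by
  refine ⟨fun x => (hC x).1.comp (hJ.1 x), IsCP.sum fun x _ => (hC x).1.comp (hJ.1 x),
    fun ρ => ?_⟩
  rw [← hJ.2.2 ρ]
  simp [LinearMap.sum_apply, trace_sum, (hC _).2]

theorem IsInstrument.combo {X : Type*} [Fintype X] {J J' : X → Matrix n n ℂ →ₗ[ℂ] Matrix m m ℂ}
    (hJ : IsInstrument J) (hJ' : IsInstrument J') {α β : ℝ} (hα : 0 ≤ α) (hβ : 0 ≤ β)
    (hab : α + β = 1) : IsInstrument fun x => α • J x + β • J' x := by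
  have hcp : ∀ x, IsCP (α • J x + β • J' x) := fun x =>
    ((hJ.1 x).smul hα).add ((hJ'.1 x).smul hβ)
  refine ⟨hcp, IsCP.sum fun x _ => hcp x, fun ρ => ?_⟩
  have h1 := hJ.2.2 ρ
  have h2 := hJ'.2.2 ρ
  rw [Finset.sum_add_distrib, ← Finset.smul_sum, ← Finset.smul_sum, LinearMap.add_apply,
    LinearMap.smul_apply, LinearMap.smul_apply, trace_add, trace_smul, trace_smul, h1, h2,
    ← add_smul, hab, one_smul]

end CP

section Adjoint

variable {n m : Type*} [Fintype m] [DecidableEq n]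

theorem adjointMap_add (Φ Ψ : Matrix n n ℂ →ₗ[ℂ] Matrix m m ℂ) (M : Matrix m m ℂ) :
    adjointMap (Φ + Ψ) M = adjointMap Φ M + adjointMap Ψ M := by
  ext i j
  simp [adjointMap, add_mul]

theorem adjointMap_smul (r : ℝ) (Φ : Matrix n n ℂ →ₗ[ℂ] Matrix m m ℂ) (M : Matrix m m ℂ) :
    adjointMap (r • Φ) M = r • adjointMap Φ M := by
  ext i j
  simp [adjointMap]

theorem adjointMap_sum {ι : Type*} (s : Finset ι) (Φ : ι → Matrix n n ℂ →ₗ[ℂ] Matrix m m ℂ)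
    (M : Matrix m m ℂ) : adjointMap (∑ i ∈ s, Φ i) M = ∑ i ∈ s, adjointMap (Φ i) M := by
  ext i j
  simp [adjointMap, Finset.sum_mul, trace_sum, Matrix.sum_apply]

variable [Fintype n]

theorem adjointMap_mulLeftRight (A B M : Matrix n n ℂ) :
    adjointMap (LinearMap.mulLeftRight ℂ (A, B)) M = B * M * A := by
  ext i j
  rw [adjointMap, of_apply, LinearMap.mulLeftRight_apply, mul_assoc, trace_mul_comm, ← mul_assoc,
    trace_mul_comm, ← mul_assoc, trace_mul_comm, ← mul_assoc]
  simp [trace, mul_apply, single_apply, ite_and, mul_comm]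

theorem eq_of_trace_mul_eq {A B : Matrix n n ℂ} (h : ∀ ρ, (ρ * A).trace = (ρ * B).trace) :
    A = B := by
  ext i j
  have := h (single j i 1)
  simpa [trace, mul_apply, single_apply, ite_and] using this

theorem adjointMap_comp [DecidableEq m] {l : Type*} [Fintype l]
    (Φ : Matrix n n ℂ →ₗ[ℂ] Matrix m m ℂ)
    (Ψ : Matrix m m ℂ →ₗ[ℂ] Matrix l l ℂ) (M : Matrix l l ℂ) :
    adjointMap (Ψ ∘ₗ Φ) M = adjointMap Φ (adjointMap Ψ M) :=
  eq_of_trace_mul_eq fun ρ => by simp only [trace_mul_adjointMap, LinearMap.comp_apply]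

end Adjoint

/-! ### Sharp meters -/

/-- A complete family of mutually orthogonal projections. -/
structure IsSharp {d : ℕ} (Q : Fin d → Matrix (Fin d) (Fin d) ℂ) : Prop where
  herm : ∀ x, (Q x)ᴴ = Q x
  mul_self : ∀ x, Q x * Q x = Q x
  mul_of_ne : ∀ x y, x ≠ y → Q x * Q y = 0
  sum_eq : ∑ x, Q x = 1

/-- The algebraic relations between two mutually unbiased sharp meters. -/
structure IsUnbiasedPair {d : ℕ} (Q P : Fin d → Matrix (Fin d) (Fin d) ℂ) : Prop where
  left : IsSharp Q
  right : IsSharp P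
  sandwich : ∀ x y, Q x * P y * Q x = (1 / (d : ℝ)) • Q x
  sandwich' : ∀ x y, P y * Q x * P y = (1 / (d : ℝ)) • P y

theorem IsUnbiasedPair.symm {d : ℕ} {Q P : Fin d → Matrix (Fin d) (Fin d) ℂ}
    (h : IsUnbiasedPair Q P) : IsUnbiasedPair P Q :=
  ⟨h.right, h.left, fun x y => h.sandwich' y x, fun x y => h.sandwich y x⟩

section Sharp

variable {d : ℕ} (φ : OrthonormalBasis (Fin d) ℂ (EuclideanSpace ℂ (Fin d)))

theorem dotProduct_orthonormalBasis (x y : Fin d) :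
    star (φ x).ofLp ⬝ᵥ (φ y).ofLp = if x = y then 1 else 0 := by
  rw [dotProduct_comm, ← EuclideanSpace.inner_eq_star_dotProduct]
  exact orthonormal_iff_ite.1 φ.orthonormal x y

theorem isSharp_sharpMeter : IsSharp (sharpMeter φ) where
  herm x := by simp [sharpMeter, conjTranspose_vecMulVec]
  mul_self x := by
    simp [sharpMeter, vecMulVec_mul_vecMulVec, dotProduct_orthonormalBasis]
  mul_of_ne x y h := by
    simp [sharpMeter, vecMulVec_mul_vecMulVec, dotProduct_orthonormalBasis, h]
  sum_eq := by
    -- For the matrix `U` with columns `φ x`, orthonormality is `Uᴴ U = 1`; the sum of the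
    -- projections is `U Uᴴ`.
    have h : (Matrix.of fun i x => (φ x).ofLp i)ᴴ * (Matrix.of fun i x => (φ x).ofLp i)
        = (1 : Matrix (Fin d) (Fin d) ℂ) := by
      ext x y
      have := dotProduct_orthonormalBasis φ x y
      simpa [mul_apply, one_apply, dotProduct] using this
    rw [← mul_eq_one_comm.1 h]
    ext i j
    simp [sharpMeter, mul_apply, vecMulVec_apply, Matrix.sum_apply]

/-- Rank one is used here: it upgrades the trace condition of unbiasedness to the operator relations
of `IsUnbiasedPair`. -/
theorem sharpMeter_mul_mul (x : Fin d) (B : Matrix (Fin d) (Fin d) ℂ) :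
    sharpMeter φ x * B * sharpMeter φ x = (sharpMeter φ x * B).trace • sharpMeter φ x := by
  rw [trace_mul_comm, mul_assoc]
  simp only [sharpMeter, mul_vecMulVec, vecMulVec_mulVec, trace_vecMulVec, op_smul_eq_smul,
    smul_vecMulVec]
  rw [dotProduct_comm]

theorem isUnbiasedPair_sharpMeter {ψ : OrthonormalBasis (Fin d) ℂ (EuclideanSpace ℂ (Fin d))}
    (h : MutuallyUnbiased (sharpMeter φ) (sharpMeter ψ)) :
    IsUnbiasedPair (sharpMeter φ) (sharpMeter ψ) where
  left := isSharp_sharpMeter φ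
  right := isSharp_sharpMeter ψ
  sandwich x y := by
    rw [sharpMeter_mul_mul, h x y, ← Complex.coe_smul]
    simp
  sandwich' x y := by
    rw [sharpMeter_mul_mul, trace_mul_comm, h x y, ← Complex.coe_smul]
    simp

end Sharp

/-! ### A bound for pairs of projections in isotropic position -/

section Bound

variable {n : Type*} [Fintype n]

theorem trace_real_smul (r : ℝ) (A : Matrix n n ℂ) : (r • A).trace = (r : ℂ) * A.trace := by
  rw [trace_smul]
  exact Complex.real_smul

variable [DecidableEq n]

theorem trace_mul_nonneg_of_posSemidef {A B : Matrix n n ℂ} (hA : A.PosSemidef)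
    (hB : B.PosSemidef) : 0 ≤ (A * B).trace := by
  obtain ⟨C, rfl⟩ := CStarAlgebra.nonneg_iff_eq_star_mul_self.1 hB.nonneg
  rw [← mul_assoc, trace_mul_comm, ← mul_assoc, star_eq_conjTranspose]
  exact (hA.mul_mul_conjTranspose_same C).trace_nonneg

/-- The operator inequality `P ≤ (1 + k) c Q + (1 + 1 / k) (1 - c) (1 - Q)`. -/
theorem posSemidef_of_sandwich {Q P : Matrix n n ℂ} {c k : ℝ} (hQ : Qᴴ = Q) (hP : Pᴴ = P)
    (hQQ : Q * Q = Q) (hPP : P * P = P) (hQPQ : Q * P * Q = c • Q) (hPQP : P * Q * P = c • P)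
    (hc : c < 1) (hk : 0 < k) :
    (((1 + k) * c) • Q + ((1 + 1 / k) * (1 - c)) • (1 - Q) - P).PosSemidef := by
  set R := 1 - Q with hR
  have hRH : Rᴴ = R := by simp [R, hQ]
  have hRR : R * R = R := by simp [R, mul_sub, sub_mul, hQQ]
  have hPRP : P * R * P = (1 - c) • P := by
    simp only [R, mul_sub, sub_mul, mul_one, hPP, hPQP]; module
  have h1c : 0 < 1 - c := by linarith
  -- The square `Xᴴ X` controls the cross terms `QPR + RPQ` in the style of Young's inequality. As
  -- `PRP = (1-c) P`, the matrix `RPR / (1-c)` is a projection below `R`, and `Z` is its complement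
  -- in `R`.
  set X := (√k) • (P * Q) - (√k)⁻¹ • (P * R)
  set Z := R - (1 - c)⁻¹ • (R * P * R)
  have hsk : √k ≠ 0 := (Real.sqrt_pos.2 hk).ne'
  have hk2 := Real.mul_self_sqrt hk.le
  have eX : Xᴴ * X = k • (Q * P * Q) + k⁻¹ • (R * P * R) - (Q * P * R + R * P * Q) := by
    have a1 : ∀ A B : Matrix n n ℂ, A * P * (P * B) = A * P * B := fun A B => by
      rw [mul_assoc, ← mul_assoc P, hPP, ← mul_assoc]
    simp only [X, conjTranspose_sub, conjTranspose_smul, conjTranspose_mul, hP, hQ, hRH,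
      star_trivial, sub_mul, mul_sub, smul_mul_assoc, mul_smul_comm, a1]
    simp only [smul_smul, smul_sub, hk2, ← mul_inv, mul_inv_cancel₀ hsk, inv_mul_cancel₀ hsk]
    module
  have eZ : Zᴴ * Z = R - (1 - c)⁻¹ • (R * P * R) := by
    have b1 : R * (R * P * R) = R * P * R := by rw [← mul_assoc, ← mul_assoc, hRR]
    have b2 : R * P * R * R = R * P * R := by rw [mul_assoc, hRR]
    have b3 : R * P * R * (R * P * R) = (1 - c) • (R * P * R) := by
      rw [← mul_assoc, ← mul_assoc, b2, mul_assoc R P R, mul_assoc R (P * R) P, hPRP,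
        mul_smul_comm, smul_mul_assoc, mul_assoc R P R]
    have hZ : Zᴴ = Z := by
      simp [Z, conjTranspose_mul, hRH, hP, mul_assoc]
    rw [hZ]
    simp only [Z, sub_mul, mul_sub, smul_mul_assoc, mul_smul_comm, hRR, b1, b2, b3]
    rw [inv_smul_smul₀ h1c.ne']
    module
  have hsum : ((1 + k) * c) • Q + ((1 + 1 / k) * (1 - c)) • R - P
      = Xᴴ * X + ((1 + 1 / k) * (1 - c)) • (Zᴴ * Z) := by
    have e : P = Q * P * Q + R * P * R + (Q * P * R + R * P * Q) := by
      conv_lhs => rw [show P = (Q + R) * P * (Q + R) by simp [R]]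
      simp only [add_mul, mul_add]; abel
    rw [eX, eZ]
    conv_lhs => rw [e]
    have e' : ((1 + 1 / k) * (1 - c)) • (R - (1 - c)⁻¹ • (R * P * R))
        = ((1 + 1 / k) * (1 - c)) • R - (1 + 1 / k) • (R * P * R) := by
      rw [smul_sub, smul_smul, mul_assoc, mul_inv_cancel₀ h1c.ne', mul_one]
    rw [hQPQ, e', one_div]
    module
  rw [hsum]
  exact (posSemidef_conjTranspose_mul_self X).add
    ((posSemidef_conjTranspose_mul_self Z).smul (by positivity))

/-- Stated for a family so as to serve twice: joint meters use pairs of outcomes with `N = d`,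
cloning uses one index with `N = d²`. -/
theorem le_tradeoff_of_projections {ι : Type*} [Fintype ι] {N : ℕ} (hN : 2 ≤ N)
    {G Q P : ι → Matrix n n ℂ} (hG : ∀ i, (G i).PosSemidef) (hQ : ∀ i, (Q i)ᴴ = Q i)
    (hP : ∀ i, (P i)ᴴ = P i) (hQQ : ∀ i, Q i * Q i = Q i) (hPP : ∀ i, P i * P i = P i)
    (hQPQ : ∀ i, Q i * P i * Q i = (1 / (N : ℝ)) • Q i)
    (hPQP : ∀ i, P i * Q i * P i = (1 / (N : ℝ)) • P i) {T s t : ℝ} (hT : 0 < T)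
    (hs : s ∈ Icc (minNoise N 1) 1) (h0 : ∑ i, (G i).trace = (T : ℂ))
    (h1 : ∑ i, (G i * Q i).trace = ((T * ((s * ((N : ℝ) - 1) + 1) / N) : ℝ) : ℂ))
    (h2 : ∑ i, (G i * P i).trace = ((T * ((t * ((N : ℝ) - 1) + 1) / N) : ℝ) : ℂ)) :
    t ≤ 1 - noiseA N s ^ 2 := by
  have hN' : (2 : ℝ) ≤ N := by exact_mod_cast hN
  refine le_tradeoff hN hs fun k hk => ?_
  have hc : 1 / (N : ℝ) < 1 := by rw [div_lt_one] <;> linarith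
  generalize (s * ((N : ℝ) - 1) + 1) / N = u at h1 ⊢
  generalize (t * ((N : ℝ) - 1) + 1) / N = v at h2 ⊢
  have key : 0 ≤ ∑ i, (G i * (((1 + k) * (1 / (N : ℝ))) • Q i
      + ((1 + 1 / k) * (1 - 1 / (N : ℝ))) • (1 - Q i) - P i)).trace :=
    Finset.sum_nonneg fun i _ => trace_mul_nonneg_of_posSemidef (hG i)
      (posSemidef_of_sandwich (hQ i) (hP i) (hQQ i) (hPP i) (hQPQ i) (hPQP i) hc hk)
  simp only [mul_add, mul_sub (G _), mul_smul_comm, trace_add, trace_sub, trace_real_smul, mul_one,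
    Finset.sum_add_distrib, Finset.sum_sub_distrib, ← Finset.mul_sum, h0, h1, h2] at key
  norm_cast at key
  by_contra! hcon
  nlinarith [mul_lt_mul_of_pos_left hcon hT]

end Bound

/-! ### Noisy sharp meters and the Lüders instrument -/

section Luders

variable {d : ℕ} {Q P : Fin d → Matrix (Fin d) (Fin d) ℂ}

theorem conj_expand (w a : ℝ) (A B : Matrix (Fin d) (Fin d) ℂ) :
    (w • (1 : Matrix (Fin d) (Fin d) ℂ) + a • A) * B * (w • 1 + a • A)
      = w ^ 2 • B + (w * a) • (A * B + B * A) + a ^ 2 • (A * B * A) := by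
  simp only [add_mul, mul_add, smul_mul_assoc, mul_smul_comm, one_mul, mul_one]
  module

theorem IsSharp.posSemidef (hQ : IsSharp Q) (x : Fin d) : (Q x).PosSemidef := by
  have := posSemidef_conjTranspose_mul_self (Q x)
  rwa [hQ.herm, hQ.mul_self] at this

theorem IsSharp.posSemidef_compl (hQ : IsSharp Q) (x : Fin d) : (1 - Q x).PosSemidef := by
  have := posSemidef_conjTranspose_mul_self (1 - Q x)
  rwa [conjTranspose_sub, conjTranspose_one, hQ.herm, mul_sub, sub_mul, sub_mul, hQ.mul_self,
    one_mul, one_mul, mul_one, sub_self, sub_zero] at this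

theorem sqrt_noisy (hd : 2 ≤ d) (hQ : IsSharp Q) {s : ℝ} (hs : s ∈ Icc (minNoise d 1) 1)
    (x : Fin d) : CFC.sqrt (noisy s Q x)
      = √((1 - s) / d) • (1 : Matrix (Fin d) (Fin d) ℂ) + noiseA d s • Q x := by
  have hd0 : (0 : ℝ) < d := by exact_mod_cast (by omega : 0 < d)
  obtain ⟨h1, h2⟩ := noiseA_spec hd hs
  have hw2 := sqrt_noise_sq hd hs
  apply CFC.sqrt_unique
  · have := conj_expand √((1 - s) / d) (noiseA d s) (Q x) 1
    simp only [mul_one, one_mul, hQ.mul_self] at this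
    rw [this, noisy, hw2]
    have e : s = 2 * noiseA d s * √((1 - s) / d) + noiseA d s ^ 2 := by
      rw [hw2] at h1
      field_simp at h1
      linarith
    match_scalars
    · ring
    · linear_combination -e
  · rw [nonneg_iff_posSemidef]
    have : √((1 - s) / d) • (1 : Matrix (Fin d) (Fin d) ℂ) + noiseA d s • Q x
        = √((1 - s) / d) • (1 - Q x) + (√((1 - s) / d) + noiseA d s) • Q x := by module
    rw [this]
    exact ((hQ.posSemidef_compl x).smul (Real.sqrt_nonneg _)).add ((hQ.posSemidef x).smul h2)

theorem posSemidef_noisy (hd : 2 ≤ d) (hQ : IsSharp Q) {s : ℝ} (hs : s ∈ Icc (minNoise d 1) 1)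
    (x : Fin d) : (noisy s Q x).PosSemidef := by
  have hd0 : (0 : ℝ) < d := by exact_mod_cast (by omega : 0 < d)
  obtain ⟨h1, h2⟩ := minNoise_one_bounds hd hs
  have : noisy s Q x = ((s * ((d : ℝ) - 1) + 1) / d) • Q x + ((1 - s) / d) • (1 - Q x) := by
    rw [noisy]
    match_scalars <;> field_simp
    ring
  rw [this]
  exact ((hQ.posSemidef x).smul (by positivity)).add
    ((hQ.posSemidef_compl x).smul (by positivity))

theorem sqrt_noisy_mul_self (hd : 2 ≤ d) (hQ : IsSharp Q) {s : ℝ}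
    (hs : s ∈ Icc (minNoise d 1) 1) (x : Fin d) :
    CFC.sqrt (noisy s Q x) * CFC.sqrt (noisy s Q x) = noisy s Q x :=
  CFC.sqrt_mul_sqrt_self _ (nonneg_iff_posSemidef.2 (posSemidef_noisy hd hQ hs x))

theorem conjTranspose_sqrt (A : Matrix (Fin d) (Fin d) ℂ) : (CFC.sqrt A)ᴴ = CFC.sqrt A :=
  (nonneg_iff_posSemidef.1 (CFC.sqrt_nonneg A)).isHermitian

theorem sum_noisy (hd : 2 ≤ d) (hQ : IsSharp Q) (s : ℝ) : ∑ x, noisy s Q x = 1 := by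
  have hd0 : (d : ℝ) ≠ 0 := by exact_mod_cast (by omega : d ≠ 0)
  simp only [noisy, Finset.sum_add_distrib, ← Finset.smul_sum, hQ.sum_eq, Finset.sum_const,
    Finset.card_univ, Fintype.card_fin]
  rw [← Nat.cast_smul_eq_nsmul ℝ]
  match_scalars
  field_simp
  ring

theorem adjointMap_luders (s : ℝ) (x : Fin d) (M : Matrix (Fin d) (Fin d) ℂ) :
    adjointMap (luders Q s x) M = CFC.sqrt (noisy s Q x) * M * CFC.sqrt (noisy s Q x) := by
  rw [luders, adjointMap_mulLeftRight]

theorem adjointMap_ludersThen (s : ℝ)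
    (C : Fin d → Matrix (Fin d) (Fin d) ℂ →ₗ[ℂ] Matrix (Fin d) (Fin d) ℂ) (x : Fin d)
    (M : Matrix (Fin d) (Fin d) ℂ) : adjointMap (ludersThen Q s C x) M
      = CFC.sqrt (noisy s Q x) * adjointMap (C x) M * CFC.sqrt (noisy s Q x) := by
  rw [ludersThen, adjointMap_comp, adjointMap_luders]

theorem adjointMap_luders_one (hd : 2 ≤ d) (hQ : IsSharp Q) {s : ℝ}
    (hs : s ∈ Icc (minNoise d 1) 1) (x : Fin d) : adjointMap (luders Q s x) 1 = noisy s Q x := by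
  rw [adjointMap_luders, mul_one, sqrt_noisy_mul_self hd hQ hs]

theorem isInstrument_luders (hd : 2 ≤ d) (hQ : IsSharp Q) {s : ℝ}
    (hs : s ∈ Icc (minNoise d 1) 1) : IsInstrument (luders Q s) := by
  have hcp : ∀ x, IsCP (luders Q s x) := fun x =>
    IsCP.conj_of_isHermitian (conjTranspose_sqrt _)
  refine ⟨hcp, IsCP.sum fun x _ => hcp x, fun ρ => ?_⟩
  have h : adjointMap (∑ x, luders Q s x) 1 = 1 := by
    rw [adjointMap_sum, Finset.sum_congr rfl fun x _ => adjointMap_luders_one hd hQ hs x,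
      sum_noisy hd hQ]
  have := trace_mul_adjointMap (∑ x, luders Q s x) 1 ρ
  rw [h, mul_one, mul_one] at this
  exact this.symm

theorem isInstrument_ludersThen (hd : 2 ≤ d) (hQ : IsSharp Q) {s : ℝ}
    (hs : s ∈ Icc (minNoise d 1) 1)
    {C : Fin d → Matrix (Fin d) (Fin d) ℂ →ₗ[ℂ] Matrix (Fin d) (Fin d) ℂ}
    (hC : ∀ x, IsChannel (C x)) : IsInstrument (ludersThen Q s C) :=
  (isInstrument_luders hd hQ hs).comp hC

theorem isChannel_reflection (hQ : IsSharp Q) (x : Fin d) : IsChannel (reflection Q x) := by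
  have hH : (1 - (2 : ℝ) • Q x)ᴴ = 1 - (2 : ℝ) • Q x := by simp [hQ.herm]
  refine ⟨IsCP.conj_of_isHermitian hH, fun ρ => ?_⟩
  have h : (1 - (2 : ℝ) • Q x) * (1 - (2 : ℝ) • Q x) = 1 := by
    simp only [mul_sub, sub_mul, smul_mul_assoc, mul_smul_comm, one_mul, mul_one, hQ.mul_self]
    module
  rw [reflection, LinearMap.mulLeftRight_apply, trace_mul_comm, ← mul_assoc, h, one_mul]

theorem IsJointMeter.of_marginals {X Y n : Type*} [Fintype X] [Fintype Y] [Fintype n]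
    [DecidableEq n] {G : X × Y → Matrix n n ℂ} {M : X → Matrix n n ℂ} {N : Y → Matrix n n ℂ}
    (hG : ∀ p, (G p).PosSemidef) (h1 : ∀ x, ∑ y, G (x, y) = M x)
    (h2 : ∀ y, ∑ x, G (x, y) = N y) (hM : ∑ x, M x = 1) : IsJointMeter G M N := by
  refine ⟨⟨hG, ?_⟩, h1, h2⟩
  rw [Fintype.sum_prod_type, Finset.sum_congr rfl fun x _ => h1 x, hM]

theorem IsJointMeter.swap {X Y n : Type*} [Fintype X] [Fintype Y] [Fintype n]
    [DecidableEq n] {G : X × Y → Matrix n n ℂ} {M : X → Matrix n n ℂ} {N : Y → Matrix n n ℂ}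
    (h : IsJointMeter G M N) : IsJointMeter (fun p => G (p.2, p.1)) N M := by
  refine ⟨⟨fun p => h.1.1 _, ?_⟩, h.2.2, h.2.1⟩
  rw [← h.1.2, Fintype.sum_prod_type, Fintype.sum_prod_type_right]

theorem isJointMeter_optG (hd : 2 ≤ d) (h : IsUnbiasedPair Q P) {s : ℝ}
    (hs : s ∈ Icc (minNoise d 1) 1) :
    IsJointMeter (optG Q P s) (noisy s Q) (noisy (1 - noiseA d s ^ 2) P) := by
  have hspec := (noiseA_spec hd hs).1
  refine IsJointMeter.of_marginals (fun p => ?_) (fun x => ?_) (fun y => ?_)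
    (sum_noisy hd h.left s)
  · have := (h.right.posSemidef p.2).conjTranspose_mul_mul_same (CFC.sqrt (noisy s Q p.1))
    rwa [conjTranspose_sqrt] at this
  · simp only [optG]
    rw [← Finset.sum_mul, ← Finset.mul_sum, h.right.sum_eq, mul_one,
      sqrt_noisy_mul_self hd h.left hs]
  -- The sum over `x` is `(d w² + 2aw) P(y) + (a²/d) 1`, and the quadratic gives `d w² + 2aw = 1 -
  -- a²`.
  · simp only [optG, sqrt_noisy hd h.left hs, conj_expand, h.sandwich, Finset.sum_add_distrib,
      ← Finset.smul_sum, ← Finset.sum_mul, ← Finset.mul_sum, h.left.sum_eq, Finset.sum_const,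
      Finset.card_univ, Fintype.card_fin, one_mul, mul_one]
    rw [noisy, ← Nat.cast_smul_eq_nsmul ℝ]
    match_scalars
    · linear_combination hspec
    · ring

theorem isJointMeter_optGTilde (hd : 2 ≤ d) (h : IsUnbiasedPair Q P) {t : ℝ}
    (ht : t ∈ Icc (minNoise d 1) 1) :
    IsJointMeter (optGTilde Q P t) (noisy (1 - noiseA d t ^ 2) Q) (noisy t P) :=
  (isJointMeter_optG hd h.symm ht).swap

theorem seqMeter_luders (s : ℝ) : seqMeter (luders Q s) P = optG Q P s :=
  funext fun _ => adjointMap_luders s _ _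

/-- The reflection flips the sign of the eigenvalue `w + a` on `Q(x)`, replacing `a` by the other
root `-(2w + a)` of the same quadratic. -/
theorem sqrt_conj_reflection (hd : 2 ≤ d) (hQ : IsSharp Q) {s : ℝ}
    (hs : s ∈ Icc (minNoise d 1) 1) (x : Fin d) (M : Matrix (Fin d) (Fin d) ℂ) :
    adjointMap (ludersThen Q s (reflection Q) x) M
      = (√((1 - s) / d) • 1 + (-(2 * √((1 - s) / d) + noiseA d s)) • Q x) * M
        * (√((1 - s) / d) • 1 + (-(2 * √((1 - s) / d) + noiseA d s)) • Q x) := by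
  rw [adjointMap_ludersThen, reflection, adjointMap_mulLeftRight, sqrt_noisy hd hQ hs]
  have e1 : (√((1 - s) / d) • (1 : Matrix (Fin d) (Fin d) ℂ) + noiseA d s • Q x)
      * (1 - (2 : ℝ) • Q x)
      = √((1 - s) / d) • 1 + (-(2 * √((1 - s) / d) + noiseA d s)) • Q x := by
    simp only [mul_sub, add_mul, smul_mul_assoc, mul_smul_comm, one_mul, mul_one, hQ.mul_self]
    module
  have e2 : (1 - (2 : ℝ) • Q x)
      * (√((1 - s) / d) • (1 : Matrix (Fin d) (Fin d) ℂ) + noiseA d s • Q x)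
      = √((1 - s) / d) • 1 + (-(2 * √((1 - s) / d) + noiseA d s)) • Q x := by
    simp only [sub_mul, mul_add, smul_mul_assoc, mul_smul_comm, one_mul, mul_one, hQ.mul_self]
    module
  rw [← mul_assoc, ← mul_assoc, e1, mul_assoc, e2]

theorem seqMeter_luders_eq_optGTilde (hd : 2 ≤ d) (h : IsUnbiasedPair Q P) {t : ℝ}
    (ht : t ∈ Icc (minNoise d 1) 1) (h0 : 0 ≤ t) :
    seqMeter (luders Q (1 - noiseA d t ^ 2)) P = optGTilde Q P t := by
  have hd0 : (0 : ℝ) < d := by exact_mod_cast (by omega : 0 < d)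
  have hsd := (Real.sqrt_pos.2 hd0).ne'
  have hd2 := Real.sq_sqrt hd0.le
  rw [seqMeter_luders]
  funext ⟨x, y⟩
  simp only [optG, optGTilde, sqrt_noisy hd h.left (tradeoff_mem hd ht),
    sqrt_noisy hd h.right ht, conj_expand, h.sandwich, h.sandwich', sqrt_tradeoff,
    abs_of_nonneg ((noiseA_sign hd).1 h0), noiseA_tradeoff_of_nonneg hd ht h0]
  match_scalars
  · rw [div_pow, hd2]; ring
  · field_simp
  · field_simp
  · rw [mul_pow, hd2]; field_simp

theorem seqMeter_reflection_eq_optGTilde (hd : 2 ≤ d) (h : IsUnbiasedPair Q P) {t : ℝ}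
    (ht : t ∈ Icc (minNoise d 1) 1) (h0 : t ≤ 0) :
    seqMeter (ludersThen Q (1 - noiseA d t ^ 2) (reflection Q)) P = optGTilde Q P t := by
  have hd0 : (0 : ℝ) < d := by exact_mod_cast (by omega : 0 < d)
  have hsd := (Real.sqrt_pos.2 hd0).ne'
  have hd2 := Real.sq_sqrt hd0.le
  funext ⟨x, y⟩
  -- For `t ≤ 0` the coefficient of `QP + PQ` in `optGTilde` is nonpositive, so the root `-√d w` is
  -- required; the reflection supplies it.
  have hcoef : -(2 * (-noiseA d t / √(d : ℝ)) + (√(d : ℝ) * √((1 - t) / d)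
      + 2 * noiseA d t / √d)) = -(√(d : ℝ) * √((1 - t) / d)) := by ring
  simp only [seqMeter, optGTilde, sqrt_conj_reflection hd h.left (tradeoff_mem hd ht),
    sqrt_noisy hd h.right ht, conj_expand, h.sandwich, h.sandwich', sqrt_tradeoff,
    abs_of_nonpos ((noiseA_sign hd).2 h0), noiseA_tradeoff_of_nonpos hd ht h0, hcoef]
  match_scalars
  · rw [div_pow, hd2]; ring
  · field_simp
  · field_simp
  · rw [neg_sq, mul_pow, hd2]; field_simp

end Luders

/-! ### Dimension two -/

section Qubit

variable {Q P : Fin 2 → Matrix (Fin 2) (Fin 2) ℂ}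

theorem IsSharp.exists_compl (hQ : IsSharp Q) (x : Fin 2) : ∃ x', Q x' = 1 - Q x := by
  have h := hQ.sum_eq
  rw [Fin.sum_univ_two] at h
  fin_cases x
  · exact ⟨1, by rw [← h]; simp⟩
  · exact ⟨0, by rw [← h]; simp⟩

/-- Relative to `Q`, the diagonal part of `P(y)` is `1/2` and the reflection negates the
off-diagonal part, so `P(y)` goes to `1 - P(y)`. -/
theorem reflection_conj (h : IsUnbiasedPair Q P) (x y : Fin 2) :
    (1 - (2 : ℝ) • Q x) * P y * (1 - (2 : ℝ) • Q x) = noisy (-1) P y := by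
  obtain ⟨x', hx'⟩ := h.left.exists_compl x
  have h1 := h.sandwich x y
  have h2 := h.sandwich x' y
  rw [hx'] at h2
  simp only [mul_sub, sub_mul, one_mul, mul_one, h1] at h2
  simp only [mul_sub, sub_mul, smul_mul_assoc, mul_smul_comm, one_mul, mul_one, h1, noisy]
  push_cast at h2 ⊢
  linear_combination (norm := module) (2 : ℝ) • h2

theorem isJointMeter_optGMinus (h : IsUnbiasedPair Q P) {s : ℝ}
    (hs : s ∈ Icc (minNoise 2 1) 1) :
    IsJointMeter (optGMinus Q P s) (noisy s Q) (noisy (-(1 - noiseA 2 s ^ 2)) P) := by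
  have hm : (-1 : ℝ) ∈ Icc (minNoise 2 1) 1 := by rw [minNoise_two_one]; norm_num
  refine IsJointMeter.of_marginals (fun p => ?_) (fun x => ?_) (fun y => ?_)
    (sum_noisy le_rfl h.left s)
  · have := (posSemidef_noisy le_rfl h.right hm p.2).conjTranspose_mul_mul_same
      (CFC.sqrt (noisy s Q p.1))
    rwa [conjTranspose_sqrt] at this
  · simp only [optGMinus]
    rw [← Finset.sum_mul, ← Finset.mul_sum, sum_noisy le_rfl h.right, mul_one,
      sqrt_noisy_mul_self le_rfl h.left hs]
  · have h1 := (isJointMeter_optG le_rfl h hs).2.2 y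
    have h2 : ∀ x, optGMinus Q P s (x, y) = noisy s Q x - optG Q P s (x, y) := fun x => by
      have : noisy (-1) P y = 1 - P y := by rw [noisy]; push_cast; module
      rw [optGMinus, optG, this, mul_sub, sub_mul, mul_one, sqrt_noisy_mul_self le_rfl h.left hs]
    simp only [h2, Finset.sum_sub_distrib, h1, sum_noisy le_rfl h.left]
    simp only [noisy]
    push_cast
    module

theorem seqMeter_eq_optGMinus (h : IsUnbiasedPair Q P) (s : ℝ) :
    seqMeter (ludersThen Q s (reflection Q)) P = optGMinus Q P s := by
  funext ⟨x, y⟩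
  rw [seqMeter, adjointMap_ludersThen, reflection, adjointMap_mulLeftRight, reflection_conj h,
    optGMinus]

end Qubit

/-! ### The corner point -/

section Corner

variable {d : ℕ} {Q P : Fin d → Matrix (Fin d) (Fin d) ℂ}

/-- The Schur multiplier, in the basis of `Q`, with off-diagonal entries `-1 / (d - 2)` on the
complement of `Q x`. -/
noncomputable def cornerChannel (Q : Fin d → Matrix (Fin d) (Fin d) ℂ) (x : Fin d) :
    Matrix (Fin d) (Fin d) ℂ →ₗ[ℂ] Matrix (Fin d) (Fin d) ℂ :=
  (1 / (2 * ((d : ℝ) - 2))) • ∑ i ∈ Finset.univ.erase x, ∑ j ∈ Finset.univ.erase x,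
    LinearMap.mulLeftRight ℂ (Q i - Q j, Q i - Q j) + LinearMap.mulLeftRight ℂ (Q x, Q x)

/-- In the expanded Kraus sum the terms `Q i M Q i` are explicit by `hM`, and the cross terms add up
to the compression of `M` by `1 - Q x`. It is used with `M = 1`, `c = 1` and with `M = P y`, `c =
1/d`. -/
theorem adjointMap_cornerChannel (hd : 3 ≤ d) (hQ : IsSharp Q) (x : Fin d)
    {M : Matrix (Fin d) (Fin d) ℂ} {c : ℝ} (hM : ∀ i, Q i * M * Q i = c • Q i) :
    adjointMap (cornerChannel Q x) M
      = (1 / (2 * ((d : ℝ) - 2))) • ((2 * ((d : ℝ) - 1) * c) • (1 - Q x)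
        - (2 : ℝ) • ((1 - Q x) * M * (1 - Q x))) + c • Q x := by
  have hsum : ∑ i ∈ Finset.univ.erase x, Q i = 1 - Q x := by
    rw [← hQ.sum_eq, ← Finset.add_sum_erase _ _ (Finset.mem_univ x)]; abel
  have hcard : ((Finset.univ.erase x).card : ℝ) = d - 1 := by
    rw [Finset.card_erase_of_mem (Finset.mem_univ x), Finset.card_univ, Fintype.card_fin,
      Nat.cast_sub (by omega), Nat.cast_one]
  simp only [cornerChannel, adjointMap_add, adjointMap_smul, adjointMap_sum,
    adjointMap_mulLeftRight, hM]
  simp only [sub_mul, mul_sub (_ * M), hM, Finset.sum_sub_distrib, Finset.sum_const,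
    ← Finset.smul_sum, ← Finset.sum_mul, ← Finset.mul_sum, hsum]
  rw [← Nat.cast_smul_eq_nsmul ℝ, hcard]
  simp only [sub_mul, mul_sub]
  module

theorem isChannel_cornerChannel (hd : 3 ≤ d) (hQ : IsSharp Q) (x : Fin d) :
    IsChannel (cornerChannel Q x) := by
  have hd' : (3 : ℝ) ≤ d := by exact_mod_cast hd
  refine ⟨?_, fun ρ => ?_⟩
  · have h0 : (0 : ℝ) ≤ 1 / (2 * ((d : ℝ) - 2)) := by
      apply div_nonneg zero_le_one; linarith
    refine IsCP.add (IsCP.smul (IsCP.sum fun i _ => IsCP.sum fun j _ => ?_) h0)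
      (IsCP.conj_of_isHermitian (hQ.herm x))
    exact IsCP.conj_of_isHermitian (by rw [conjTranspose_sub, hQ.herm, hQ.herm])
  · have h1 : adjointMap (cornerChannel Q x) 1 = 1 := by
      rw [adjointMap_cornerChannel hd hQ x (M := 1) (c := 1) fun i => by
        rw [mul_one, one_smul, hQ.mul_self]]
      have hne : (d : ℝ) - 2 ≠ 0 := by linarith
      simp only [mul_sub, sub_mul, mul_one, one_mul, hQ.mul_self]
      match_scalars <;> field_simp <;> ring
    have := trace_mul_adjointMap (cornerChannel Q x) 1 ρ
    rw [h1, mul_one, mul_one] at this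
    exact this.symm

/-- At the least noise parameter the eigenvalue on `Q x` vanishes. This later annihilates the `Q x`
term of the corner channel. -/
theorem sqrt_noisy_minNoise (hd : 2 ≤ d) (hQ : IsSharp Q) (x : Fin d) :
    CFC.sqrt (noisy (minNoise d 1) Q x) = √(1 / ((d : ℝ) - 1)) • (1 - Q x) := by
  have hd' : (2 : ℝ) ≤ d := by exact_mod_cast hd
  have h1 : (1 - minNoise d 1) / d = 1 / ((d : ℝ) - 1) := by
    have : (d : ℝ) - 1 ≠ 0 := by linarith
    rw [minNoise, pow_one]; field_simp; ring
  have h2 : minNoise d 1 * ((d : ℝ) - 1) + 1 = 0 := by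
    rw [minNoise, pow_one, div_mul_cancel₀] <;> linarith
  have h3 : noiseA d (minNoise d 1) = -√(1 / ((d : ℝ) - 1)) := by
    rw [noiseA, h2, Real.sqrt_zero, zero_sub, neg_div, ← h1,
      Real.sqrt_div (minNoise_one_bounds hd (minNoise_one_mem hd)).2]
  rw [sqrt_noisy hd hQ (minNoise_one_mem hd), h1, h3]
  module

theorem seqMeter_eq_optGCorner (hd : 3 ≤ d) (h : IsUnbiasedPair Q P) :
    seqMeter (ludersThen Q (minNoise d 1) (cornerChannel Q)) P = optGCorner Q P := by
  have hd' : (3 : ℝ) ≤ d := by exact_mod_cast hd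
  have hne : (d : ℝ) - 2 ≠ 0 := by linarith
  have hne1 : (d : ℝ) - 1 ≠ 0 := by linarith
  have hs := Real.mul_self_sqrt (show (0 : ℝ) ≤ 1 / ((d : ℝ) - 1) by
    apply div_nonneg zero_le_one; linarith)
  funext ⟨x, y⟩
  have hR : (1 - Q x) * (1 - Q x) = 1 - Q x := by
    simp [mul_sub, sub_mul, h.left.mul_self]
  have hRQ : (1 - Q x) * Q x = 0 := by simp [sub_mul, h.left.mul_self]
  have hRPR : (1 - Q x) * P y * (1 - Q x)
      = P y - Q x * P y - P y * Q x + (1 / (d : ℝ)) • Q x := by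
    simp only [mul_sub, sub_mul, mul_one, one_mul, h.sandwich]
    abel
  have e : ∀ w α β c : ℝ, w • (1 - Q x) * (α • (β • (1 - Q x)
      - (2 : ℝ) • ((1 - Q x) * P y * (1 - Q x))) + c • Q x) * w • (1 - Q x)
      = (w * w * α) • (β • (1 - Q x) - (2 : ℝ) • ((1 - Q x) * P y * (1 - Q x))) := by
    intro w α β c
    have e1 : (1 - Q x) * ((1 - Q x) * P y * (1 - Q x)) * (1 - Q x)
        = (1 - Q x) * P y * (1 - Q x) := by
      rw [← mul_assoc, ← mul_assoc, hR, mul_assoc, hR]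
    generalize 1 - Q x = R at *
    simp only [smul_mul_assoc, mul_smul_comm, mul_add, mul_sub, add_mul, sub_mul, e1, hR, hRQ,
      zero_mul, smul_zero]
    module
  rw [seqMeter, adjointMap_ludersThen, sqrt_noisy_minNoise (by omega) h.left,
    adjointMap_cornerChannel hd h.left x fun i => h.sandwich i y, optGCorner, e, hs, hRPR]
  simp only [pow_two, mul_sub, sub_mul, h.left.mul_self, h.right.mul_self]
  match_scalars <;> field_simp
  ring

theorem isJointMeter_optGCorner (hd : 3 ≤ d) (h : IsUnbiasedPair Q P) :
    IsJointMeter (optGCorner Q P) (noisy (minNoise d 1) Q) (noisy (minNoise d 1) P) := by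
  have hd' : (3 : ℝ) ≤ d := by exact_mod_cast hd
  have hne : (d : ℝ) - 2 ≠ 0 := by linarith
  have hne1 : (d : ℝ) - 1 ≠ 0 := by linarith
  have hm : (1 - minNoise d 1) / d = 1 / ((d : ℝ) - 1) := by
    rw [minNoise, pow_one]; field_simp; ring
  have hsq : ∀ x y, (Q x - P y) ^ 2 = Q x + P y - (Q x * P y + P y * Q x) := fun x y => by
    rw [pow_two, sub_mul, mul_sub, mul_sub, h.left.mul_self, h.right.mul_self]; abel
  refine IsJointMeter.of_marginals (fun p => ?_) (fun x => ?_) (fun y => ?_)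
    (sum_noisy (by omega) h.left _)
  -- By unbiasedness `A² = (1 - 1/d) A`, so `d/(d-1) A` is a projection and the bracket in
  -- `optGCorner` is the complementary one.
  · set A := (Q p.1 - P p.2) ^ 2 with hA
    have hd0 : (d : ℝ) ≠ 0 := by linarith
    have hAQ : A * Q p.1 = (1 - 1 / (d : ℝ)) • Q p.1 := by
      simp only [hA, hsq, sub_mul, add_mul, h.left.mul_self, h.sandwich, mul_assoc (P p.2)]
      module
    have hAP : A * P p.2 = (1 - 1 / (d : ℝ)) • P p.2 := by
      simp only [hA, hsq, sub_mul, add_mul, h.right.mul_self, h.sandwich', mul_assoc (Q p.1)]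
      module
    have hAA : A * A = (1 - 1 / (d : ℝ)) • A := by
      have : A * A = A * (Q p.1 + P p.2 - (Q p.1 * P p.2 + P p.2 * Q p.1)) := by rw [← hsq]
      rw [this, mul_sub, mul_add, mul_add, ← mul_assoc, ← mul_assoc, hAQ, hAP, hA, hsq]
      simp only [smul_mul_assoc]
      module
    have hAH : Aᴴ = A := by
      rw [hA, conjTranspose_pow, conjTranspose_sub, h.left.herm, h.right.herm]
    have hZ : (1 - ((d : ℝ) / (d - 1)) • A)ᴴ * (1 - ((d : ℝ) / (d - 1)) • A)
        = 1 - ((d : ℝ) / (d - 1)) • A := by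
      rw [conjTranspose_sub, conjTranspose_smul, hAH, conjTranspose_one, star_trivial]
      simp only [mul_sub, sub_mul, mul_one, one_mul, smul_mul_assoc, mul_smul_comm, hAA]
      match_scalars <;> field_simp
      ring
    have := posSemidef_conjTranspose_mul_self (1 - ((d : ℝ) / (d - 1)) • A)
    rw [hZ] at this
    refine this.smul (div_nonneg zero_le_one (mul_nonneg ?_ ?_)) <;> linarith
  · simp only [optGCorner, hsq, ← Finset.smul_sum, Finset.sum_sub_distrib, Finset.sum_add_distrib,
      ← Finset.sum_mul, ← Finset.mul_sum, h.right.sum_eq, Finset.sum_const, Finset.card_univ,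
      Fintype.card_fin, noisy, hm, mul_one, one_mul]
    simp only [← Nat.cast_smul_eq_nsmul ℝ, minNoise, pow_one]
    match_scalars <;> field_simp <;> ring
  · simp only [optGCorner, hsq, ← Finset.smul_sum, Finset.sum_sub_distrib, Finset.sum_add_distrib,
      ← Finset.sum_mul, ← Finset.mul_sum, h.left.sum_eq, Finset.sum_const, Finset.card_univ,
      Fintype.card_fin, noisy, hm, mul_one, one_mul]
    simp only [← Nat.cast_smul_eq_nsmul ℝ, minNoise, pow_one]
    match_scalars <;> field_simp <;> ring

end Corner

/-! ### The joint and sequential regions -/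

section Regions

variable {d : ℕ} {Q P : Fin d → Matrix (Fin d) (Fin d) ℂ}

theorem exists_channels_of_mem_optimalParameters (hd : 2 ≤ d) (hQ : IsSharp Q) {p : ℝ × ℝ}
    (hp : p ∈ optimalParameters d) :
    ∃ C : Fin d → Matrix (Fin d) (Fin d) ℂ →ₗ[ℂ] Matrix (Fin d) (Fin d) ℂ,
      (∀ x, IsChannel (C x)) ∧ ∀ P, IsUnbiasedPair Q P →
        IsJointMeter (seqMeter (ludersThen Q p.1 C) P) (noisy p.1 Q) (noisy p.2 P) := by
  obtain ⟨s, t⟩ := p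
  obtain ⟨hs, ht, h⟩ := hp
  simp only at hs ht h ⊢
  have hid : ∀ r, ludersThen Q r (fun _ => LinearMap.id) = luders Q r := fun r => rfl
  rcases h with rfl | rfl | ⟨rfl, rfl⟩ | ⟨hd3, hst⟩
  · refine ⟨fun _ => LinearMap.id, fun _ => IsChannel.id, fun P hP => ?_⟩
    rw [hid, seqMeter_luders]
    exact isJointMeter_optG hd hP hs
  · rcases le_total 0 t with h0 | h0
    · refine ⟨fun _ => LinearMap.id, fun _ => IsChannel.id, fun P hP => ?_⟩
      rw [hid, seqMeter_luders_eq_optGTilde hd hP ht h0]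
      exact isJointMeter_optGTilde hd hP ht
    · refine ⟨reflection Q, isChannel_reflection hQ, fun P hP => ?_⟩
      rw [seqMeter_reflection_eq_optGTilde hd hP ht h0]
      exact isJointMeter_optGTilde hd hP ht
  · refine ⟨reflection Q, isChannel_reflection hQ, fun P hP => ?_⟩
    rw [seqMeter_eq_optGMinus hP]
    exact isJointMeter_optGMinus hP hs
  · obtain ⟨rfl, rfl⟩ := Prod.mk.inj hst
    refine ⟨cornerChannel Q, isChannel_cornerChannel hd3 hQ, fun P hP => ?_⟩
    rw [seqMeter_eq_optGCorner hd3 hP]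
    exact isJointMeter_optGCorner hd3 hP

theorem noisy_combo {α β : ℝ} (hab : α + β = 1) (s s' : ℝ) (x : Fin d) :
    noisy (α * s + β * s') Q x = α • noisy s Q x + β • noisy s' Q x := by
  simp only [noisy]
  match_scalars
  · ring
  · linear_combination (-(1 : ℝ) / d) * hab

theorem seqMeter_combo (J J' : Fin d → Matrix (Fin d) (Fin d) ℂ →ₗ[ℂ] Matrix (Fin d) (Fin d) ℂ)
    (α β : ℝ) (p : Fin d × Fin d) : seqMeter (fun x => α • J x + β • J' x) P p
      = α • seqMeter J P p + β • seqMeter J' P p := by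
  simp only [seqMeter, adjointMap_add, adjointMap_smul]

/-- The mixture of the two instruments is itself independent of `P`, so it serves every unbiased `P`
at once. -/
theorem convex_sequentialRegion : Convex ℝ (sequentialRegion Q) := by
  rintro ⟨s, t⟩ ⟨hs, ht, J, hJ, h⟩ ⟨s', t'⟩ ⟨hs', ht', J', hJ', h'⟩ α β hα hβ hab
  refine ⟨convex_Icc _ _ hs hs' hα hβ hab, convex_Icc _ _ ht ht' hα hβ hab,
    fun x => α • J x + β • J' x, hJ.combo hJ' hα hβ hab, fun ψ hψ => ?_⟩
  obtain ⟨⟨a1, a2⟩, a3, a4⟩ := h ψ hψ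
  obtain ⟨⟨b1, b2⟩, b3, b4⟩ := h' ψ hψ
  simp only at a3 a4 b3 b4
  refine ⟨⟨fun p => ?_, ?_⟩, fun x => ?_, fun y => ?_⟩
  · rw [seqMeter_combo]
    exact ((a1 p).smul hα).add ((b1 p).smul hβ)
  · simp only [seqMeter_combo, Finset.sum_add_distrib, ← Finset.smul_sum, a2, b2]
    rw [← add_smul, hab, one_smul]
  · simp only [seqMeter_combo, Finset.sum_add_distrib, ← Finset.smul_sum, a3, b3]
    exact (noisy_combo hab s s' x).symm
  · simp only [seqMeter_combo, Finset.sum_add_distrib, ← Finset.smul_sum, a4, b4]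
    exact (noisy_combo hab t t' y).symm

theorem optimalParameters_subset_sequentialRegion (hd : 2 ≤ d)
    (φ : OrthonormalBasis (Fin d) ℂ (EuclideanSpace ℂ (Fin d))) :
    optimalParameters d ⊆ sequentialRegion (sharpMeter φ) := by
  intro p hp
  obtain ⟨C, hC, h⟩ := exists_channels_of_mem_optimalParameters hd (isSharp_sharpMeter φ) hp
  exact ⟨hp.1, hp.2.1, _, isInstrument_ludersThen hd (isSharp_sharpMeter φ) hp.1 hC,
    fun ψ hψ => h _ (isUnbiasedPair_sharpMeter φ hψ)⟩

theorem tradeoffRegion_subset_sequentialRegion (hd : 2 ≤ d)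
    (φ : OrthonormalBasis (Fin d) ℂ (EuclideanSpace ℂ (Fin d))) :
    tradeoffRegion d ⊆ sequentialRegion (sharpMeter φ) :=
  (tradeoffRegion_subset_convexHull hd).trans
    (convexHull_min (optimalParameters_subset_sequentialRegion hd φ) convex_sequentialRegion)

theorem sum_trace_noisy_mul (hd : 2 ≤ d) (hQ : IsSharp Q) (s : ℝ) :
    ∑ x, (noisy s Q x * Q x).trace
      = (((d : ℝ) * ((s * ((d : ℝ) - 1) + 1) / d) : ℝ) : ℂ) := by
  have hd0 : (d : ℝ) ≠ 0 := by exact_mod_cast (by omega : d ≠ 0)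
  have : ∀ x, noisy s Q x * Q x = ((s * ((d : ℝ) - 1) + 1) / d) • Q x := fun x => by
    rw [noisy, add_mul, smul_mul_assoc, hQ.mul_self, smul_mul_assoc, one_mul, ← add_smul]
    congr 1
    field_simp
    ring
  simp only [this]
  rw [← trace_sum, ← Finset.smul_sum, hQ.sum_eq, trace_real_smul, trace_one, Fintype.card_fin]
  push_cast
  ring

theorem IsJointMeter.le_tradeoff (hd : 2 ≤ d) (h : IsUnbiasedPair Q P) {s t : ℝ}
    (hs : s ∈ Icc (minNoise d 1) 1) {G : Fin d × Fin d → Matrix (Fin d) (Fin d) ℂ}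
    (hG : IsJointMeter G (noisy s Q) (noisy t P)) : t ≤ 1 - noiseA d s ^ 2 := by
  refine le_tradeoff_of_projections hd (T := d) (Q := fun p => Q p.1) (P := fun p => P p.2)
    hG.1.1 (fun p => h.left.herm _) (fun p => h.right.herm _) (fun p => h.left.mul_self _)
    (fun p => h.right.mul_self _) (fun p => h.sandwich _ _) (fun p => h.sandwich' _ _)
    (by exact_mod_cast (by omega : 0 < d)) hs ?_ ?_ ?_
  · rw [← trace_sum, hG.1.2, trace_one, Fintype.card_fin]
    norm_cast
  · rw [Fintype.sum_prod_type, ← sum_trace_noisy_mul hd h.left]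
    refine Finset.sum_congr rfl fun x _ => ?_
    rw [← trace_sum, ← hG.2.1, Finset.sum_mul]
  · rw [Fintype.sum_prod_type_right, ← sum_trace_noisy_mul hd h.right]
    refine Finset.sum_congr rfl fun x _ => ?_
    rw [← trace_sum, ← hG.2.2, Finset.sum_mul]

theorem IsUnbiasedPair.comp_equiv (h : IsUnbiasedPair Q P) (σ : Equiv.Perm (Fin d)) :
    IsUnbiasedPair Q (P ∘ σ) where
  left := h.left
  right :=
    { herm := fun _ => h.right.herm _
      mul_self := fun _ => h.right.mul_self _
      mul_of_ne := fun _ _ hxy => h.right.mul_of_ne _ _ (σ.injective.ne hxy)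
      sum_eq := (Equiv.sum_comp σ P).trans h.right.sum_eq }
  sandwich x _ := h.sandwich x _
  sandwich' x _ := h.sandwich' x _

/-- Exchanging the two outcomes of `P` reverses the sign of `t`; this yields the extra inequality
for `d = 2` from the general one. -/
theorem noisy_neg_comp_rev {P : Fin 2 → Matrix (Fin 2) (Fin 2) ℂ} (hP : IsSharp P) (t : ℝ) :
    noisy (-t) (P ∘ Fin.revPerm) = noisy t P := by
  have h := hP.sum_eq
  rw [Fin.sum_univ_two] at h
  have key : ∀ x, P (Fin.revPerm x) = 1 - P x := by
    intro x
    fin_cases x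
    · rw [← h]; simp
    · rw [← h]; simp
  funext x
  simp only [noisy, Function.comp, key]
  push_cast
  module

theorem jointRegion_subset_tradeoffRegion (hd : 2 ≤ d) (h : IsUnbiasedPair Q P) :
    jointRegion Q P ⊆ tradeoffRegion d := by
  rintro ⟨s, t⟩ ⟨hs, ht, G, hG⟩
  refine ⟨hs, ht, hG.le_tradeoff hd h hs, hG.swap.le_tradeoff hd h.symm ht, ?_⟩
  rintro rfl
  simp only at hG ⊢
  rw [← noisy_neg_comp_rev h.right] at hG
  exact hG.le_tradeoff hd (h.comp_equiv Fin.revPerm) hs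

theorem sequentialRegion_subset_jointRegion
    (φ ψ : OrthonormalBasis (Fin d) ℂ (EuclideanSpace ℂ (Fin d)))
    (h : MutuallyUnbiased (sharpMeter φ) (sharpMeter ψ)) :
    sequentialRegion (sharpMeter φ) ⊆ jointRegion (sharpMeter φ) (sharpMeter ψ) :=
  fun _ ⟨hs, ht, J, _, hG⟩ => ⟨hs, ht, seqMeter J (sharpMeter ψ), hG ψ h⟩

theorem jointRegion_eq_tradeoffRegion (hd : 2 ≤ d)
    (φ ψ : OrthonormalBasis (Fin d) ℂ (EuclideanSpace ℂ (Fin d)))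
    (h : MutuallyUnbiased (sharpMeter φ) (sharpMeter ψ)) :
    jointRegion (sharpMeter φ) (sharpMeter ψ) = tradeoffRegion d :=
  (jointRegion_subset_tradeoffRegion hd (isUnbiasedPair_sharpMeter φ h)).antisymm
    ((tradeoffRegion_subset_sequentialRegion hd φ).trans
      (sequentialRegion_subset_jointRegion φ ψ h))

theorem sequentialRegion_eq_jointRegion (hd : 2 ≤ d)
    (φ ψ : OrthonormalBasis (Fin d) ℂ (EuclideanSpace ℂ (Fin d)))
    (h : MutuallyUnbiased (sharpMeter φ) (sharpMeter ψ)) :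
    sequentialRegion (sharpMeter φ) = jointRegion (sharpMeter φ) (sharpMeter ψ) :=
  (sequentialRegion_subset_jointRegion φ ψ h).antisymm
    (jointRegion_eq_tradeoffRegion hd φ ψ h ▸ tradeoffRegion_subset_sequentialRegion hd φ)

theorem extremePoints_jointRegion (hd : 2 ≤ d)
    (φ ψ : OrthonormalBasis (Fin d) ℂ (EuclideanSpace ℂ (Fin d)))
    (h : MutuallyUnbiased (sharpMeter φ) (sharpMeter ψ)) :
    extremePoints ℝ (jointRegion (sharpMeter φ) (sharpMeter ψ)) = optimalParameters d := by
  have hJ := jointRegion_eq_tradeoffRegion hd φ ψ h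
  have hopt : optimalParameters d ⊆ tradeoffRegion d := hJ ▸
    (optimalParameters_subset_sequentialRegion hd φ).trans
      (sequentialRegion_subset_jointRegion φ ψ h)
  have hconv : tradeoffRegion d = convexHull ℝ (optimalParameters d) := by
    refine (tradeoffRegion_subset_convexHull hd).antisymm (convexHull_min hopt ?_)
    rw [← hJ, ← sequentialRegion_eq_jointRegion hd φ ψ h]
    exact convex_sequentialRegion
  rw [hJ]
  refine Subset.antisymm ?_ fun p hp => optimalParameters_extreme hd hp (hopt hp)
  rw [hconv]
  exact extremePoints_convexHull_subset

end Regions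

/-! ### Cloning -/

section Cloning

variable {d : ℕ}

/-- The Choi matrix of a linear map. -/
noncomputable def choi
    (Γ : Matrix (Fin d) (Fin d) ℂ →ₗ[ℂ] Matrix (Fin d × Fin d) (Fin d × Fin d) ℂ) :
    Matrix (Fin d × Fin d × Fin d) (Fin d × Fin d × Fin d) ℂ :=
  Matrix.of fun p q => Γ (single p.1 q.1 1) p.2 q.2

theorem posSemidef_choi
    {Γ : Matrix (Fin d) (Fin d) ℂ →ₗ[ℂ] Matrix (Fin d × Fin d) (Fin d × Fin d) ℂ}
    (hΓ : IsCP Γ) : (choi Γ).PosSemidef := by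
  -- The unnormalized maximally entangled vector; the ampliation of `Γ` sends its rank-one matrix to
  -- the Choi matrix.
  set v : Fin d × Fin d → ℂ := fun p => if p.1 = p.2 then 1 else 0
  have h := hΓ d _ (posSemidef_vecMulVec_self_star v)
  have e : ampliation d Γ (vecMulVec v (star v)) = choi Γ := by
    ext p q
    have e1 : (Matrix.of fun i j => vecMulVec v (star v) (p.1, i) (q.1, j))
        = single p.1 q.1 1 := by
      ext i j
      by_cases h1 : p.1 = i <;> by_cases h2 : q.1 = j <;> simp [v, vecMulVec_apply, h1, h2]
    simp only [ampliation, choi, of_apply, e1]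
  rwa [e] at h

/-- The isometry (up to a factor) onto the maximally entangled states of the input and the first
clone. -/
def entangleFirst (d : ℕ) : Matrix (Fin d × Fin d × Fin d) (Fin d) ℂ :=
  Matrix.of fun p m => if p.1 = p.2.1 ∧ p.2.2 = m then 1 else 0

/-- The isometry (up to a factor) onto the maximally entangled states of the input and the second
clone. -/
def entangleSecond (d : ℕ) : Matrix (Fin d × Fin d × Fin d) (Fin d) ℂ :=
  Matrix.of fun p m => if p.1 = p.2.2 ∧ p.2.1 = m then 1 else 0

theorem entangleFirst_gram : (entangleFirst d)ᴴ * entangleFirst d = (d : ℝ) • 1 := by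
  ext m n
  by_cases h : m = n
  · subst h
    simp [entangleFirst, mul_apply, Fintype.sum_prod_type, ite_and]
  · simp [entangleFirst, mul_apply, Fintype.sum_prod_type, ite_and, h, Ne.symm h]

theorem entangleSecond_gram : (entangleSecond d)ᴴ * entangleSecond d = (d : ℝ) • 1 := by
  ext m n
  by_cases h : m = n
  · subst h
    simp [entangleSecond, mul_apply, Fintype.sum_prod_type, ite_and]
  · simp [entangleSecond, mul_apply, Fintype.sum_prod_type, ite_and, h, Ne.symm h]

/-- Since each Gram matrix is `d 1`, the normalized range projections have overlap constant `1/d²`: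
they behave like an unbiased pair in dimension `d²`. -/
theorem entangle_gram : (entangleFirst d)ᴴ * entangleSecond d = 1 := by
  ext m n
  by_cases h : m = n
  · subst h
    simp [entangleFirst, entangleSecond, mul_apply, Fintype.sum_prod_type, ite_and,
      apply_ite (starRingEnd ℂ)]
  · simp [entangleFirst, entangleSecond, mul_apply, Fintype.sum_prod_type, ite_and,
      apply_ite (starRingEnd ℂ), h, Ne.symm h]

theorem trace_choi
    {Γ : Matrix (Fin d) (Fin d) ℂ →ₗ[ℂ] Matrix (Fin d × Fin d) (Fin d × Fin d) ℂ}
    (hΓ : IsChannel Γ) : (choi Γ).trace = d := by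
  have : (choi Γ).trace = ∑ i, (Γ (single i i 1)).trace := by
    simp only [trace, diag_apply, choi, of_apply]
    rw [Fintype.sum_prod_type]
  rw [this]
  simp [hΓ.2]

/-- The overlap with this projection sees only the first marginal: it is the entanglement fidelity
of the first clone, up to normalization. -/
theorem trace_choi_entangleFirst
    (Γ : Matrix (Fin d) (Fin d) ℂ →ₗ[ℂ] Matrix (Fin d × Fin d) (Fin d × Fin d) ℂ) :
    (choi Γ * (entangleFirst d * (entangleFirst d)ᴴ)).trace
      = ∑ i : Fin d, ∑ j : Fin d, firstMarginal (Γ (single i j 1)) i j := by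
  rw [← Matrix.mul_assoc, trace_mul_comm]
  simp [trace, mul_apply, Fintype.sum_prod_type, entangleFirst, choi, ite_and, firstMarginal,
    apply_ite (starRingEnd ℂ)]
  rw [Finset.sum_comm]
  exact Finset.sum_congr rfl fun i _ => Finset.sum_comm

theorem trace_choi_entangleSecond
    (Γ : Matrix (Fin d) (Fin d) ℂ →ₗ[ℂ] Matrix (Fin d × Fin d) (Fin d × Fin d) ℂ) :
    (choi Γ * (entangleSecond d * (entangleSecond d)ᴴ)).trace
      = ∑ i : Fin d, ∑ j : Fin d, secondMarginal (Γ (single i j 1)) i j := by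
  rw [← Matrix.mul_assoc, trace_mul_comm]
  simp [trace, mul_apply, Fintype.sum_prod_type, entangleSecond, choi, ite_and, secondMarginal,
    apply_ite (starRingEnd ℂ)]
  rw [Finset.sum_comm]
  exact Finset.sum_congr rfl fun i _ => Finset.sum_comm

/-- The value is `s(d² - 1) + 1`, written in the shape needed with `N = d²`: one factor `d` is the
trace of the Choi matrix, the other cancels the normalization of the projection. -/
theorem sum_depolarize (hd : 2 ≤ d) (s : ℝ) :
    ∑ i : Fin d, ∑ j : Fin d, depolarize s (single i j (1 : ℂ)) i j
      = (((d : ℝ) * ((d : ℝ) * ((s * (((d ^ 2 : ℕ) : ℝ) - 1) + 1)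
        / ((d ^ 2 : ℕ) : ℝ))) : ℝ) : ℂ) := by
  have hd0 : (d : ℂ) ≠ 0 := by exact_mod_cast (by omega : d ≠ 0)
  have : ∀ i j : Fin d, depolarize s (single i j (1 : ℂ)) i j
      = (s : ℂ) + if i = j then ((1 - s) / d : ℂ) else 0 := by
    intro i j
    by_cases h : i = j
    · subst h
      simp [depolarize]
    · simp [depolarize, h, trace_single_eq_of_ne]
  simp only [this, Finset.sum_add_distrib, Finset.sum_ite_eq, Finset.mem_univ, if_true,
    Finset.sum_const, Finset.card_univ, Fintype.card_fin]
  push_cast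
  simp only [nsmul_eq_mul]
  field_simp
  ring

theorem cloningRegion_bound (hd : 2 ≤ d) {s t : ℝ} (h : (s, t) ∈ cloningRegion d) :
    t ≤ 1 - noiseA (d ^ 2) s ^ 2 ∧ s ≤ 1 - noiseA (d ^ 2) t ^ 2 := by
  obtain ⟨hs, ht, Γ, hΓ, h1, h2⟩ := h
  simp only at hs ht h1 h2
  rw [minNoise_two_eq] at hs ht
  have hd0 : (d : ℝ) ≠ 0 := by exact_mod_cast (by omega : d ≠ 0)
  set V := entangleFirst d
  set W := entangleSecond d
  have hVW : Vᴴ * W = 1 := entangle_gram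
  have hWV : Wᴴ * V = 1 := by
    have := congrArg conjTranspose hVW
    rwa [conjTranspose_mul, conjTranspose_conjTranspose, conjTranspose_one] at this
  have herm : ∀ A : Matrix (Fin d × Fin d × Fin d) (Fin d) ℂ,
      ((1 / (d : ℝ)) • (A * Aᴴ))ᴴ = (1 / (d : ℝ)) • (A * Aᴴ) := fun A => by
    rw [conjTranspose_smul, conjTranspose_mul, conjTranspose_conjTranspose, star_trivial]
  have idem : ∀ A : Matrix (Fin d × Fin d × Fin d) (Fin d) ℂ, Aᴴ * A = (d : ℝ) • 1 →
      (1 / (d : ℝ)) • (A * Aᴴ) * (1 / (d : ℝ)) • (A * Aᴴ) = (1 / (d : ℝ)) • (A * Aᴴ) :=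
    fun A hA => by
      rw [smul_mul_assoc, mul_smul_comm, Matrix.mul_assoc, ← Matrix.mul_assoc Aᴴ, hA,
        Matrix.smul_mul, Matrix.one_mul, Matrix.mul_smul, smul_smul, smul_smul]
      congr 1
      field_simp
  have sand : ∀ A B : Matrix (Fin d × Fin d × Fin d) (Fin d) ℂ, Aᴴ * B = 1 → Bᴴ * A = 1 →
      (1 / (d : ℝ)) • (A * Aᴴ) * (1 / (d : ℝ)) • (B * Bᴴ) * (1 / (d : ℝ)) • (A * Aᴴ)
        = (1 / ((d ^ 2 : ℕ) : ℝ)) • (1 / (d : ℝ)) • (A * Aᴴ) := fun A B hAB hBA => by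
    have e : A * Aᴴ * (B * Bᴴ) * (A * Aᴴ) = A * Aᴴ := by
      rw [Matrix.mul_assoc A, ← Matrix.mul_assoc Aᴴ B, hAB, Matrix.one_mul, Matrix.mul_assoc,
        ← Matrix.mul_assoc Bᴴ, hBA, Matrix.one_mul]
    simp only [smul_mul_assoc, mul_smul_comm, e, smul_smul]
    congr 1
    push_cast
    field_simp
  have htr : ∑ _i : Unit, (choi Γ).trace = ((d : ℝ) : ℂ) := by
    simp [trace_choi hΓ]
  have hmarg : ∀ (A : Matrix (Fin d × Fin d × Fin d) (Fin d) ℂ) (r : ℝ),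
      (choi Γ * (A * Aᴴ)).trace
        = ∑ i : Fin d, ∑ j : Fin d, depolarize r (single i j (1 : ℂ)) i j →
      ∑ _i : Unit, (choi Γ * (1 / (d : ℝ)) • (A * Aᴴ)).trace
        = (((d : ℝ) * ((r * (((d ^ 2 : ℕ) : ℝ) - 1) + 1) / ((d ^ 2 : ℕ) : ℝ)) : ℝ) : ℂ) := by
    intro A r hA
    rw [sum_depolarize hd] at hA
    rw [Finset.sum_const, Finset.card_univ, Fintype.card_unit, one_smul, mul_smul_comm,
      trace_real_smul, hA, ← Complex.ofReal_mul]
    congr 1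
    field_simp
  have hV : (choi Γ * (V * Vᴴ)).trace
      = ∑ i : Fin d, ∑ j : Fin d, depolarize s (single i j (1 : ℂ)) i j := by
    rw [trace_choi_entangleFirst]; simp only [h1]
  have hW : (choi Γ * (W * Wᴴ)).trace
      = ∑ i : Fin d, ∑ j : Fin d, depolarize t (single i j (1 : ℂ)) i j := by
    rw [trace_choi_entangleSecond]; simp only [h2]
  have hpos : (0 : ℝ) < d := by exact_mod_cast (by omega : 0 < d)
  have hd2 : 2 ≤ d ^ 2 := by nlinarith
  have hC : ∀ _i : Unit, (choi Γ).PosSemidef := fun _ => posSemidef_choi hΓ.1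
  have iV := idem V entangleFirst_gram
  have iW := idem W entangleSecond_gram
  exact ⟨le_tradeoff_of_projections hd2 hC (fun _ => herm V) (fun _ => herm W) (fun _ => iV)
      (fun _ => iW) (fun _ => sand V W hVW hWV) (fun _ => sand W V hWV hVW) hpos hs htr
      (hmarg V s hV) (hmarg W t hW),
    le_tradeoff_of_projections hd2 hC (fun _ => herm W) (fun _ => herm V) (fun _ => iW)
      (fun _ => iV) (fun _ => sand W V hWV hVW) (fun _ => sand V W hVW hWV) hpos ht htr
      (hmarg W t hW) (hmarg V s hV)⟩

theorem cloningRegion_subset_sequentialRegion (hd : 2 ≤ d)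
    (φ : OrthonormalBasis (Fin d) ℂ (EuclideanSpace ℂ (Fin d))) :
    cloningRegion d ⊆ sequentialRegion (sharpMeter φ) := fun _ hp =>
  tradeoffRegion_subset_sequentialRegion hd φ <|
    mem_tradeoffRegion_of_sq hd hp.1 hp.2.1 (cloningRegion_bound hd hp).1
      (cloningRegion_bound hd hp).2

theorem graph_not_mem_cloningRegion (hd : 2 ≤ d) {s : ℝ} (hs : s ∈ Icc (minNoise d 2) 1)
    (h0 : s ≠ 0) (h1 : s ≠ 1) : (s, 1 - noiseA d s ^ 2) ∉ cloningRegion d := fun h => by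
  have hlt := noiseA_sq_lt hd (by nlinarith : d < d ^ 2)
    ⟨(minNoise_one_le_two hd).trans hs.1, hs.2⟩ (minNoise_two_eq d ▸ hs) h0 h1
  linarith [(cloningRegion_bound hd h).1]

end Cloning

theorem mainTheorem6 (d : ℕ) (hd : 2 ≤ d)
    (φ : OrthonormalBasis (Fin d) ℂ (EuclideanSpace ℂ (Fin d)))
    (Q : Fin d → Matrix (Fin d) (Fin d) ℂ) (hQ : Q = sharpMeter φ) :
    -- the first measurement: the Lüders instrument measures `Q_s`
    (∀ s ∈ Icc (minNoise d 1) 1,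
      IsInstrument (luders Q s) ∧ ∀ x, adjointMap (luders Q s x) 1 = noisy s Q x) ∧
    (∀ x, IsChannel (reflection Q x)) ∧
    -- `G^(s)` is obtained without post-processing
    (∀ s ∈ Icc (minNoise d 1) 1,
      ∀ ψ : OrthonormalBasis (Fin d) ℂ (EuclideanSpace ℂ (Fin d)),
        MutuallyUnbiased Q (sharpMeter ψ) →
          IsJointMeter (optG Q (sharpMeter ψ) s)
            (noisy s Q) (noisy (1 - noiseA d s ^ 2) (sharpMeter ψ)) ∧
          seqMeter (luders Q s) (sharpMeter ψ) = optG Q (sharpMeter ψ) s) ∧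
    -- `G̃^(t)` is obtained without post-processing if `t ≥ 0`, and by reflection if `t < 0`
    (∀ t ∈ Icc (minNoise d 1) 1,
      1 - noiseA d t ^ 2 ∈ Icc (0 : ℝ) 1 ∧
      ∀ ψ : OrthonormalBasis (Fin d) ℂ (EuclideanSpace ℂ (Fin d)),
        MutuallyUnbiased Q (sharpMeter ψ) →
          IsJointMeter (optGTilde Q (sharpMeter ψ) t)
            (noisy (1 - noiseA d t ^ 2) Q) (noisy t (sharpMeter ψ)) ∧
          (0 ≤ t → seqMeter (luders Q (1 - noiseA d t ^ 2)) (sharpMeter ψ)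
            = optGTilde Q (sharpMeter ψ) t) ∧
          (t < 0 → seqMeter (ludersThen Q (1 - noiseA d t ^ 2) (reflection Q)) (sharpMeter ψ)
            = optGTilde Q (sharpMeter ψ) t)) ∧
    -- `G_-^(s)`, for `d = 2`, is obtained by reflection
    (d = 2 → ∀ s ∈ Icc (-1 : ℝ) 1,
      ∀ ψ : OrthonormalBasis (Fin d) ℂ (EuclideanSpace ℂ (Fin d)),
        MutuallyUnbiased Q (sharpMeter ψ) →
          IsJointMeter (optGMinus Q (sharpMeter ψ) s)
            (noisy s Q) (noisy (-(1 - noiseA d s ^ 2)) (sharpMeter ψ)) ∧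
          seqMeter (ludersThen Q s (reflection Q)) (sharpMeter ψ)
            = optGMinus Q (sharpMeter ψ) s) ∧
    -- `G_corner`, for `d ≥ 3`, with conditional channels that do not depend on `P`
    (3 ≤ d → ∃ C : Fin d → Matrix (Fin d) (Fin d) ℂ →ₗ[ℂ] Matrix (Fin d) (Fin d) ℂ,
      (∀ x, IsChannel (C x)) ∧
      ∀ ψ : OrthonormalBasis (Fin d) ℂ (EuclideanSpace ℂ (Fin d)),
        MutuallyUnbiased Q (sharpMeter ψ) →
          IsJointMeter (optGCorner Q (sharpMeter ψ))
            (noisy (minNoise d 1) Q) (noisy (minNoise d 1) (sharpMeter ψ)) ∧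
          seqMeter (ludersThen Q (minNoise d 1) C) (sharpMeter ψ)
            = optGCorner Q (sharpMeter ψ)) ∧
    -- these meters are the optimal ones: their parameters are the extreme points of `ECR(Q,P)`
    (∀ ψ : OrthonormalBasis (Fin d) ℂ (EuclideanSpace ℂ (Fin d)),
      MutuallyUnbiased Q (sharpMeter ψ) →
        extremePoints ℝ (jointRegion Q (sharpMeter ψ)) =
          {p : ℝ × ℝ | p.1 ∈ Icc (minNoise d 1) 1 ∧ p.2 ∈ Icc (minNoise d 1) 1 ∧
            (p.2 = 1 - noiseA d p.1 ^ 2 ∨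
              p.1 = 1 - noiseA d p.2 ^ 2 ∨
              (d = 2 ∧ p.2 = -(1 - noiseA d p.1 ^ 2)) ∨
              (3 ≤ d ∧ p = (minNoise d 1, minNoise d 1)))}) ∧
    -- every extreme point is reached by the Lüders instrument of `Q_s` followed by conditional
    -- channels that do not depend on `P`
    (∀ ψ : OrthonormalBasis (Fin d) ℂ (EuclideanSpace ℂ (Fin d)),
      MutuallyUnbiased Q (sharpMeter ψ) →
        ∀ p ∈ extremePoints ℝ (jointRegion Q (sharpMeter ψ)),
          ∃ C : Fin d → Matrix (Fin d) (Fin d) ℂ →ₗ[ℂ] Matrix (Fin d) (Fin d) ℂ,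
            (∀ x, IsChannel (C x)) ∧
            ∀ ψ' : OrthonormalBasis (Fin d) ℂ (EuclideanSpace ℂ (Fin d)),
              MutuallyUnbiased Q (sharpMeter ψ') →
                IsJointMeter (seqMeter (ludersThen Q p.1 C) (sharpMeter ψ'))
                  (noisy p.1 Q) (noisy p.2 (sharpMeter ψ'))) ∧
    -- same trade-off as the joint measurement of a specific pair
    (∀ ψ : OrthonormalBasis (Fin d) ℂ (EuclideanSpace ℂ (Fin d)),
      MutuallyUnbiased Q (sharpMeter ψ) →
        sequentialRegion Q = jointRegion Q (sharpMeter ψ)) ∧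
    -- strict advantage over cloning
    cloningRegion d ⊂ sequentialRegion Q ∧
    (∀ s ∈ Icc (minNoise d 2) 1, s ≠ 0 → s ≠ 1 →
      (s, 1 - noiseA d s ^ 2) ∈ sequentialRegion Q ∧
      (s, 1 - noiseA d s ^ 2) ∉ cloningRegion d) := by
  subst hQ
  have hQ := isSharp_sharpMeter φ
  have hpair := fun ψ hψ => isUnbiasedPair_sharpMeter φ (ψ := ψ) hψ
  have hmem : ∀ {s : ℝ}, s ∈ Icc (minNoise d 2) 1 → s ∈ Icc (minNoise d 1) 1 :=
    fun hs => ⟨(minNoise_one_le_two hd).trans hs.1, hs.2⟩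
  have hgraph : ∀ {s : ℝ}, s ∈ Icc (minNoise d 2) 1 →
      (s, 1 - noiseA d s ^ 2) ∈ sequentialRegion (sharpMeter φ) := fun hs =>
    optimalParameters_subset_sequentialRegion hd φ (graph_mem_optimalParameters hd (hmem hs))
  refine ⟨fun s hs => ⟨isInstrument_luders hd hQ hs, adjointMap_luders_one hd hQ hs⟩,
    isChannel_reflection hQ,
    fun s hs ψ hψ => ⟨isJointMeter_optG hd (hpair ψ hψ) hs, seqMeter_luders s⟩,
    fun t ht => ⟨tradeoff_mem_unit hd ht, fun ψ hψ =>
      ⟨isJointMeter_optGTilde hd (hpair ψ hψ) ht,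
        seqMeter_luders_eq_optGTilde hd (hpair ψ hψ) ht,
        fun h0 => seqMeter_reflection_eq_optGTilde hd (hpair ψ hψ) ht h0.le⟩⟩,
    ?_,
    fun hd3 => ⟨cornerChannel (sharpMeter φ), isChannel_cornerChannel hd3 hQ, fun ψ hψ =>
      ⟨isJointMeter_optGCorner hd3 (hpair ψ hψ), seqMeter_eq_optGCorner hd3 (hpair ψ hψ)⟩⟩,
    extremePoints_jointRegion hd φ,
    fun ψ hψ p hp => ?_,
    sequentialRegion_eq_jointRegion hd φ,
    ⟨cloningRegion_subset_sequentialRegion hd φ, fun hsub => ?_⟩,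
    fun s hs h0 h1 => ⟨hgraph hs, graph_not_mem_cloningRegion hd hs h0 h1⟩⟩
  · rintro rfl s hs ψ hψ
    rw [← minNoise_two_one] at hs
    exact ⟨isJointMeter_optGMinus (hpair ψ hψ) hs, seqMeter_eq_optGMinus (hpair ψ hψ) s⟩
  · rw [extremePoints_jointRegion hd φ ψ hψ] at hp
    obtain ⟨C, hC, h⟩ := exists_channels_of_mem_optimalParameters hd hQ hp
    exact ⟨C, hC, fun ψ' hψ' => h _ (hpair ψ' hψ')⟩
  -- Any admissible `s` other than 0 and 1 witnesses strictness.
  · have hs : (1 / 2 : ℝ) ∈ Icc (minNoise d 2) 1 := by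
      rw [minNoise_two_eq]
      have := minNoise_one_neg (by nlinarith : 2 ≤ d ^ 2)
      exact ⟨by linarith, by norm_num⟩
    exact graph_not_mem_cloningRegion hd hs (by norm_num) (by norm_num) (hsub (hgraph hs))
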